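/- **Setting.** A *profile* is a curve $\Gamma=\{(r(\alpha),z(\alpha)) : \alpha\in[0,1]\}$ of class $C^4$ in the meridian half plane, with constant speed ($r_\alpha r_{\alpha\alpha}+z_\alpha z_{\alpha\alpha}=0$), without self-intersections, with unit tangent $\hat\tau=(r_\alpha,z_\alpha)/\sqrt{r_\alpha^2+z_\alpha^2}$ and continuous tangent angle $\theta(\alpha)\in(-\pi,\pi]$, $\hat\tau=(\cos\theta,\sin\theta)$; its mean curvature is $$H=\frac{r_\alpha z_{\alpha\alpha}-z_\alpha r_{\alpha\alpha}}{2(r_\alpha^2+z_\alpha^2)^{3/2}}+\frac{z_\alpha}{2r\sqrt{r_\alpha^2+z_\alpha^2}} .$$ Fix $\mathcal A,\mathcal B>0$. Consider time-dependent profiles $\Gamma_i(t)=\{(r_i(\alpha,t),z_i(\alpha,t))\}$, $i=1,2,3$, with tangent vectors $\hat\tau_i$, angles $\theta_i$ and mean curvatures $H_i$, such that $$r_{i\alpha}z_{it}-z_{i\alpha}r_{it}=\frac{-\mathcal B\,(r_iH_{i\alpha})_\alpha}{r_i\sqrt{r_{i\alpha}^2+z_{i\alpha}^2}}\ (i=1,2),\qquad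 r_{3\alpha}z_{3t}-z_{3\alpha}r_{3t}=\mathcal A\sqrt{r_{3\alpha}^2+z_{3\alpha}^2}\,H_3\qquad(\alpha\in(0,1),\ t>0),$$ and such that at each time $t\ge 0$: * $z_1(0)=z_3(0)=0$, $r_2(1)=1$, and $(r_1,z_1)(1)=(r_2,z_2)(0)=(r_3,z_3)(1)$ (the triple junction); $0<r_1(0)<r_3(0)<1$, $z_2(1)>0$, and the triple junction lies in $(0,1)\times(0,\infty)$; * $\theta_1(0)=\theta_c$, $\theta_2(1)=0$, $\theta_3(0)=\pi/2$, $-\theta_1(1)+\theta_3(1)=\beta$, $\theta_2(0)-\theta_3(1)=-\pi+\beta$ (and correspondingly $\hat\tau_1(0)\cdot\hat e_r=\cos\theta_c$, $\hat\tau_2(1)\cdot\hat e_z=0$, $\hat\tau_3(0)\cdot\hat e_r=0$, $\hat\tau_1(1)\cdot\hat\tau_3(1)=\cos\beta=-\hat\tau_2(0)\cdot\hat\tau_3(1)$); * $H_1(1)=H_2(0)$, $H_{1\alpha}(0)=0=H_{2\alpha}(1)$, and $H_{1\alpha}/\sqrt{r_{1\alpha}^2+z_{1\alpha}^2}$ at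 $\alpha=1$ equals $H_{2\alpha}/\sqrt{r_{2\alpha}^2+z_{2\alpha}^2}$ at $\alpha=0$; * $0<r_1,r_3<1$ on $[0,1]$, $0<r_2<1$ on $[0,1)$, $z_1,z_3>0$ on $(0,1]$, $z_2>0$ on $[0,1]$, and any two of the three curves meet only at the triple junction. A *steady state* for $(\beta,\theta_c)$ is a solution of this problem which does not depend on time. **Explicit curves.** For real parameters $A,\bar r,\lambda$ and $a_\ell\ge 0$ put $\bar\theta_3=\arcsin(A/\bar r)$, $\bar\theta_1=\bar\theta_3-\beta$, $\bar\theta_2=\bar\theta_3-\pi+\beta$, $\bar z=A\,\mathrm{arcosh}(\bar r/A)$, and let $\Gamma_1,\Gamma_2,\Gamma_3$ be the curves $$r_1(\theta)=\tfrac{\sin\theta-\sqrt{\sin^2\theta+4\lambda^2a_\ell^2}}{2\lambda},\quad z_1(\theta)=\tfrac{-1}{2\lambda}\int_{\bar\theta_1}^{\theta}\Bigl(\tfrac{\sin^2x}{\sqrt{\sin^2x+4\lambda^2a_\ell^2}}-\sin x\Bigr)dx+\bar z,\quad\theta\in[\bar\theta_1,\theta_c],$$ $$r_2(\theta)=\tfrac{\sin\theta-\sqrt{\sin^2\theta+4\lambda^2}}{2\lambda},\quad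 z_2(\theta)=\tfrac{-1}{2\lambda}\int_{\bar\theta_2}^{\theta}\Bigl(\tfrac{\sin^2x}{\sqrt{\sin^2x+4\lambda^2}}-\sin x\Bigr)dx+\bar z,\quad\theta\in[0,\bar\theta_2],$$ $$r_3(\theta)=\tfrac{A}{\sin\theta},\quad z_3(\theta)=A\log\tfrac{1+\cos\theta}{\sin\theta},\quad\theta\in[\bar\theta_3,\tfrac{\pi}{2}].\qquad (\ast)$$ A steady state is *given by* $(\ast)$ if the tangent angle $\theta_i(\alpha)$ of its $i$-th curve ranges exactly over the indicated interval and, as a function of the tangent angle, the $i$-th curve is $(r_i,z_i)$ of $(\ast)$, $i=1,2,3$. **Theorem.** Let $\mathcal A,\mathcal B>0$, $(\beta,\theta_c)\in(\pi/2,\pi)\times(0,\pi]$ and $(A,\sigma)\in\Omega_0=\{(A,\sigma): 0<A<1,\ 0<\sigma<\sqrt{1-A^2}\}$. Consider the parameter formulas $$\bar r=\sqrt{\sigma^2+A^2},\qquad \lambda=\frac{A\cos\beta+\sigma\sin\beta}{1-A^2-\sigma^2},\qquad a_\ell=\sqrt{\frac{(2A^2+2\sigma^2-1)A\cos\beta+\sigma\sin\beta}{A\cos\beta+\sigma\sin\beta}}\qquad(\ast\ast)$$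 and, for the curves $(\ast)$ with these parameters, the four constraints $$\tan\beta>\frac A\sigma(1-2A^2-2\sigma^2);\qquad \cos\beta<-\frac1{2A}\ \text{ if }\ \cos\beta<-\frac{A}{\sqrt{\sigma^2+A^2}};\qquad z_1(\theta_c)=0;\qquad \Gamma_1\cap\Gamma_3=\{(\bar r,\bar z)\}.\qquad(\mathrm{C})$$ (The first constraint makes the quantities in $(\ast\ast)$ well defined.) 1. With the parameters $(\ast\ast)$, $(\ast)$ gives a steady state for $(\beta,\theta_c)$ if and only if the constraints (C) hold. 2. For arbitrary real $\bar r,\lambda$ and $a_\ell\ge0$, $(\ast)$ with parameters $(A,\bar r,\lambda,a_\ell)$ gives a steady state for $(\beta,\theta_c)$ whose grain boundary $\Gamma_3$ has arc length $\sigma$ if and only if $(\ast\ast)$ and (C) hold. 3. If (C) holds, then the parameters $(\ast\ast)$ satisfy $0<\bar r<1$, $\bar z>0$, $0<\bar\theta_3<\pi/2$, $-\pi<\bar\theta_1<0$, $0<\bar\theta_2<\bar\theta_3$, $\lambda<0$, $0<a_\ell<1$. -/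

import Mathlib

noncomputable section

namespace GrainHole

open Set

/-- Derivative with respect to the curve parameter `α ∈ [0, 1]` (one-sided at the end points). -/
def dα (f : ℝ → ℝ) : ℝ → ℝ := derivWithin f (Icc 0 1)

/-- A parametrized curve `α ↦ (r α, z α)`, `α ∈ [0, 1]`, in the meridian half plane, together with
its tangent angle `θ α`. Only the values on `[0, 1]` are meaningful. -/
structure Profile where
  r : ℝ → ℝ
  z : ℝ → ℝ
  θ : ℝ → ℝ

namespace Profile

/-- `√(r_α² + z_α²)`. -/
def speed (P : Profile) (α : ℝ) : ℝ := Real.sqrt (dα P.r α ^ 2 + dα P.z α ^ 2)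

/-- Components of the unit tangent. -/
def τr (P : Profile) (α : ℝ) : ℝ := dα P.r α / P.speed α

def τz (P : Profile) (α : ℝ) : ℝ := dα P.z α / P.speed α

/-- Mean curvature of the surface of revolution generated by the curve. -/
def H (P : Profile) (α : ℝ) : ℝ :=
  (dα P.r α * dα (dα P.z) α - dα P.z α * dα (dα P.r) α) / (2 * P.speed α ^ 3)
    + dα P.z α / (2 * P.r α * P.speed α)

/-- The point set of the curve. -/
def trace (P : Profile) : Set (ℝ × ℝ) := (fun α => (P.r α, P.z α)) '' Icc 0 1

/-- Arc length. -/
def length (P : Profile) : ℝ := ∫ α in (0 : ℝ)..1, P.speed α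

/-- The parametrization is proportional to arc length, the curve does not intersect itself, and `θ`
is its tangent angle, with values in `(-π, π]`. -/
structure IsNormalized (P : Profile) : Prop where
  arclength : ∀ α ∈ Icc (0 : ℝ) 1, dα P.r α * dα (dα P.r) α + dα P.z α * dα (dα P.z) α = 0
  injective : InjOn (fun α => (P.r α, P.z α)) (Icc 0 1)
  angle_mem : ∀ α ∈ Icc (0 : ℝ) 1, P.θ α ∈ Ioc (-Real.pi) Real.pi
  cos_angle : ∀ α ∈ Icc (0 : ℝ) 1, Real.cos (P.θ α) = P.τr α
  sin_angle : ∀ α ∈ Icc (0 : ℝ) 1, Real.sin (P.θ α) = P.τz α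

end Profile

/-- The conditions which the inner exterior surface `P₁`, the outer exterior surface `P₂` and the
grain boundary `P₃` have to satisfy at each instant. -/
structure BoundaryConditions (β θc : ℝ) (P₁ P₂ P₃ : Profile) : Prop where
  normalized₁ : P₁.IsNormalized
  normalized₂ : P₂.IsNormalized
  normalized₃ : P₃.IsNormalized
  -- end points: `(r₁*, 0)`, `(1, z₂*)`, `(r₃*, 0)` and the triple junction
  start₁ : P₁.z 0 = 0
  start₃ : P₃.z 0 = 0
  end₂ : P₂.r 1 = 1
  junction₁ : P₁.r 1 = P₃.r 1 ∧ P₁.z 1 = P₃.z 1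
  junction₂ : P₂.r 0 = P₃.r 1 ∧ P₂.z 0 = P₃.z 1
  feet : 0 < P₁.r 0 ∧ P₁.r 0 < P₃.r 0 ∧ P₃.r 0 < 1
  top : 0 < P₂.z 1
  junction_mem : 0 < P₃.r 1 ∧ P₃.r 1 < 1 ∧ 0 < P₃.z 1
  -- balance of mechanical forces
  contact₁ : P₁.τr 0 = Real.cos θc ∧ P₁.θ 0 = θc
  contact₂ : P₂.τz 1 = 0 ∧ P₂.θ 1 = 0
  contact₃ : P₃.τr 0 = 0 ∧ P₃.θ 0 = Real.pi / 2
  herring₁ : P₁.τr 1 * P₃.τr 1 + P₁.τz 1 * P₃.τz 1 = Real.cos β ∧ -P₁.θ 1 + P₃.θ 1 = β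
  herring₂ : -(P₂.τr 0 * P₃.τr 1 + P₂.τz 0 * P₃.τz 1) = Real.cos β ∧
    P₂.θ 0 - P₃.θ 1 = -Real.pi + β
  -- continuity of the chemical potential and balance of the mass flux
  potential : P₁.H 1 = P₂.H 0
  flux₁ : dα P₁.H 0 = 0
  flux_junction : dα P₁.H 1 / P₁.speed 1 = dα P₂.H 0 / P₂.speed 0
  flux₂ : dα P₂.H 1 = 0
  -- persistence of the hole, the surfaces and the grain boundary
  r₁_mem : ∀ α ∈ Icc (0 : ℝ) 1, P₁.r α ∈ Ioo 0 1
  r₂_mem : ∀ α ∈ Ico (0 : ℝ) 1, P₂.r α ∈ Ioo 0 1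
  r₃_mem : ∀ α ∈ Icc (0 : ℝ) 1, P₃.r α ∈ Ioo 0 1
  z₁_pos : ∀ α ∈ Ioc (0 : ℝ) 1, 0 < P₁.z α
  z₂_pos : ∀ α ∈ Icc (0 : ℝ) 1, 0 < P₂.z α
  z₃_pos : ∀ α ∈ Ioc (0 : ℝ) 1, 0 < P₃.z α
  -- the triple junction is the only common point of any two of the curves
  inter₁₂ : P₁.trace ∩ P₂.trace = {(P₃.r 1, P₃.z 1)}
  inter₁₃ : P₁.trace ∩ P₃.trace = {(P₃.r 1, P₃.z 1)}
  inter₂₃ : P₂.trace ∩ P₃.trace = {(P₃.r 1, P₃.z 1)}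

/-- A time dependent curve `(α, t) ↦ (r α t, z α t)` with its tangent angle `θ α t`. -/
structure MovingCurve where
  r : ℝ → ℝ → ℝ
  z : ℝ → ℝ → ℝ
  θ : ℝ → ℝ → ℝ

namespace MovingCurve

/-- The curve at time `t`. -/
def at_ (M : MovingCurve) (t : ℝ) : Profile :=
  ⟨fun α => M.r α t, fun α => M.z α t, fun α => M.θ α t⟩

/-- `r_α z_t - z_α r_t`, which is the normal velocity times `√(r_α² + z_α²)`. -/
def scaledNormalVelocity (M : MovingCurve) (α t : ℝ) : ℝ :=
  dα (M.at_ t).r α * deriv (fun s => M.z α s) t - dα (M.at_ t).z α * deriv (fun s => M.r α s) t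

/-- Regularity on `[0, 1] × I`: position of class `C⁴` (all derivatives that enter the equations
are then classical) and continuous tangent angle. -/
structure IsRegular (M : MovingCurve) (I : Set ℝ) : Prop where
  contDiff_r : ContDiffOn ℝ 4 (fun p : ℝ × ℝ => M.r p.1 p.2) (Icc 0 1 ×ˢ I)
  contDiff_z : ContDiffOn ℝ 4 (fun p : ℝ × ℝ => M.z p.1 p.2) (Icc 0 1 ×ˢ I)
  continuous_θ : ContinuousOn (fun p : ℝ × ℝ => M.θ p.1 p.2) (Icc 0 1 ×ˢ I)

end MovingCurve

/-- The time interval `[0, T)`, where `T = ∞` is allowed. -/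
def timeInterval (T : EReal) : Set ℝ := {t | 0 ≤ t ∧ (t : EReal) < T}

/-- The dynamic problem on `[0, T)`: the exterior surfaces `M₁`, `M₂` move by surface diffusion with
coefficient `ℬ`, the grain boundary `M₃` moves by mean curvature with coefficient `𝒜`. -/
structure IsSolution (𝒜 ℬ β θc : ℝ) (T : EReal) (M₁ M₂ M₃ : MovingCurve) : Prop where
  regular₁ : M₁.IsRegular (timeInterval T)
  regular₂ : M₂.IsRegular (timeInterval T)
  regular₃ : M₃.IsRegular (timeInterval T)
  conditions : ∀ t ∈ timeInterval T, BoundaryConditions β θc (M₁.at_ t) (M₂.at_ t) (M₃.at_ t)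
  surfaceDiffusion : ∀ M ∈ ({M₁, M₂} : Set MovingCurve), ∀ t ∈ timeInterval T, 0 < t →
    ∀ α ∈ Ioo (0 : ℝ) 1, M.scaledNormalVelocity α t =
      -ℬ * dα (fun a => M.r a t * dα (M.at_ t).H a) α / (M.r α t * (M.at_ t).speed α)
  meanCurvatureFlow : ∀ t ∈ timeInterval T, 0 < t → ∀ α ∈ Ioo (0 : ℝ) 1,
    M₃.scaledNormalVelocity α t = 𝒜 * (M₃.at_ t).speed α * (M₃.at_ t).H α

/-- The time independent moving curve with a given profile. -/
def Profile.static (P : Profile) : MovingCurve :=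
  ⟨fun α _ => P.r α, fun α _ => P.z α, fun α _ => P.θ α⟩

/-- A steady state is a solution, for all times, which does not depend on time. -/
def IsSteadyState (𝒜 ℬ β θc : ℝ) (P₁ P₂ P₃ : Profile) : Prop :=
  IsSolution 𝒜 ℬ β θc ⊤ P₁.static P₂.static P₃.static

/-! ### The explicit curves in terms of the angle variables -/

/-- Nodoid with mean curvature `lam`: radius as a function of the angle. -/
def nodR (lam a θ : ℝ) : ℝ :=
  (Real.sin θ - Real.sqrt (Real.sin θ ^ 2 + 4 * lam ^ 2 * a ^ 2)) / (2 * lam)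

/-- Nodoid with mean curvature `lam`: height as a function of the angle, equal to `z₀` at `θ₀`. -/
def nodZ (lam a θ₀ z₀ θ : ℝ) : ℝ :=
  -1 / (2 * lam) * (∫ x in θ₀..θ,
    (Real.sin x ^ 2 / Real.sqrt (Real.sin x ^ 2 + 4 * lam ^ 2 * a ^ 2) - Real.sin x)) + z₀

/-- Catenoid. -/
def catR (A θ : ℝ) : ℝ := A / Real.sin θ

def catZ (A θ : ℝ) : ℝ := A * Real.log ((1 + Real.cos θ) / Real.sin θ)

/-- Quantities at the triple junction in terms of `A`, `rb = r̄` and `β`. -/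
def zBar (A rb : ℝ) : ℝ := A * Real.arcosh (rb / A)

def θBar₃ (A rb : ℝ) : ℝ := Real.arcsin (A / rb)

def θBar₁ (A rb β : ℝ) : ℝ := θBar₃ A rb - β

def θBar₂ (A rb β : ℝ) : ℝ := θBar₃ A rb - Real.pi + β

/-- The explicit curves with parameters `A`, `rb = r̄`, `lam = λ`, `a = a_ℓ`. -/
def r₁ (lam a θ : ℝ) : ℝ := nodR lam a θ

def z₁ (A rb lam a β θ : ℝ) : ℝ := nodZ lam a (θBar₁ A rb β) (zBar A rb) θ

def r₂ (lam θ : ℝ) : ℝ := nodR lam 1 θ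

def z₂ (A rb lam β θ : ℝ) : ℝ := nodZ lam 1 (θBar₂ A rb β) (zBar A rb) θ

def Γ₁ (A rb lam a β θc : ℝ) : Set (ℝ × ℝ) :=
  (fun θ => (r₁ lam a θ, z₁ A rb lam a β θ)) '' Icc (θBar₁ A rb β) θc

def Γ₃ (A rb : ℝ) : Set (ℝ × ℝ) :=
  (fun θ => (catR A θ, catZ A θ)) '' Icc (θBar₃ A rb) (Real.pi / 2)

/-- The tangent angle of `P` ranges over `I`, and as a function of the tangent angle the curve is
given by `(ρ, ζ)`. -/
def Profile.IsGivenBy (P : Profile) (ρ ζ : ℝ → ℝ) (I : Set ℝ) : Prop :=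
  P.θ '' Icc 0 1 = I ∧ ∀ α ∈ Icc (0 : ℝ) 1, P.r α = ρ (P.θ α) ∧ P.z α = ζ (P.θ α)

/-- `P₁`, `P₂`, `P₃` form a steady state which, in terms of the angle variables, is given by the
explicit formulas with parameters `A`, `rb = r̄`, `lam = λ`, `a = a_ℓ`. -/
def IsExplicitSteadyState (𝒜 ℬ β θc A rb lam a : ℝ) (P₁ P₂ P₃ : Profile) : Prop :=
  IsSteadyState 𝒜 ℬ β θc P₁ P₂ P₃ ∧
  P₁.IsGivenBy (r₁ lam a) (z₁ A rb lam a β) (Icc (θBar₁ A rb β) θc) ∧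
  P₂.IsGivenBy (r₂ lam) (z₂ A rb lam β) (Icc 0 (θBar₂ A rb β)) ∧
  P₃.IsGivenBy (catR A) (catZ A) (Icc (θBar₃ A rb) (Real.pi / 2))

/-! ### The parameters in terms of `A`, `σ`, `β` -/

def Ω₀ : Set (ℝ × ℝ) := {p | 0 < p.1 ∧ p.1 < 1 ∧ 0 < p.2 ∧ p.2 < Real.sqrt (1 - p.1 ^ 2)}

def rBar (A σ : ℝ) : ℝ := Real.sqrt (σ ^ 2 + A ^ 2)

def lamOf (A σ β : ℝ) : ℝ :=
  (A * Real.cos β + σ * Real.sin β) / (1 - A ^ 2 - σ ^ 2)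

def aOf (A σ β : ℝ) : ℝ :=
  Real.sqrt (((2 * A ^ 2 + 2 * σ ^ 2 - 1) * A * Real.cos β + σ * Real.sin β) /
    (A * Real.cos β + σ * Real.sin β))

/-- The four constraints on `(A, σ)` for given `(β, θc)`. -/
structure Constraints (β θc A σ : ℝ) : Prop where
  tan_gt : Real.tan β > A / σ * (1 - 2 * A ^ 2 - 2 * σ ^ 2)
  cos_lt : Real.cos β < -A / Real.sqrt (σ ^ 2 + A ^ 2) → Real.cos β < -1 / (2 * A)
  z₁_eq : z₁ A (rBar A σ) (lamOf A σ β) (aOf A σ β) β θc = 0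
  inter : Γ₁ A (rBar A σ) (lamOf A σ β) (aOf A σ β) β θc ∩ Γ₃ A (rBar A σ) =
    {(rBar A σ, zBar A (rBar A σ))}

end GrainHole

end

noncomputable section

namespace GrainHole

open Set

/-! ### Curves parametrized proportionally to arc length, with explicit tangent angle -/

/-- `P` is the curve `(ρ, ζ)`, as a function of the tangent angle, traversed at constant speed `ℓ`
with the tangent angle decreasing from `q` to `p`; `v` is the absolute value of the derivative of the
arc length with respect to the angle. -/
structure Profile.IsAngleParam (P : Profile) (ρ ζ v : ℝ → ℝ) (p q ℓ : ℝ) : Prop where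
  speed_pos : 0 < ℓ
  contDiff_r : ContDiff ℝ 4 P.r
  contDiff_z : ContDiff ℝ 4 P.z
  angle_zero : P.θ 0 = q
  angle_one : P.θ 1 = p
  v_pos : ∀ α, 0 < v (P.θ α)
  hasDerivAt_angle : ∀ α, HasDerivAt P.θ (-ℓ / v (P.θ α)) α
  hasDerivAt_r : ∀ α, HasDerivAt P.r (ℓ * Real.cos (P.θ α)) α
  hasDerivAt_z : ∀ α, HasDerivAt P.z (ℓ * Real.sin (P.θ α)) α
  r_eq : ∀ α, P.r α = ρ (P.θ α)
  z_eq : ∀ α, P.z α = ζ (P.θ α)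

theorem dα_of_hasDerivAt {f : ℝ → ℝ} {f' α : ℝ} (hα : α ∈ Icc (0 : ℝ) 1) (h : HasDerivAt f f' α) :
    dα f α = f' :=
  h.hasDerivWithinAt.derivWithin (uniqueDiffOn_Icc zero_lt_one α hα)

theorem dα_congr {f g : ℝ → ℝ} (h : EqOn f g (Icc 0 1)) {α : ℝ} (hα : α ∈ Icc (0 : ℝ) 1) :
    dα f α = dα g α :=
  derivWithin_congr h (h hα)

theorem dα_eq_zero_of_eqOn_const {f : ℝ → ℝ} {c α : ℝ} (h : ∀ x ∈ Icc (0 : ℝ) 1, f x = c)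
    (hα : α ∈ Icc (0 : ℝ) 1) : dα f α = 0 := by
  rw [dα_congr (g := fun _ => c) h hα]
  exact dα_of_hasDerivAt hα (hasDerivAt_const α c)

namespace Profile.IsAngleParam

variable {P : Profile} {ρ ζ v : ℝ → ℝ} {p q ℓ : ℝ}

theorem continuous_angle (h : P.IsAngleParam ρ ζ v p q ℓ) : Continuous P.θ :=
  continuous_iff_continuousAt.2 fun α => (h.hasDerivAt_angle α).continuousAt

theorem strictAnti_angle (h : P.IsAngleParam ρ ζ v p q ℓ) : StrictAnti P.θ := by
  refine strictAnti_of_deriv_neg fun α => ?_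
  rw [(h.hasDerivAt_angle α).deriv]
  exact div_neg_of_neg_of_pos (neg_lt_zero.2 h.speed_pos) (h.v_pos α)

theorem angle_mem_Icc (h : P.IsAngleParam ρ ζ v p q ℓ) {α : ℝ} (hα : α ∈ Icc (0 : ℝ) 1) :
    P.θ α ∈ Icc p q :=
  ⟨h.angle_one ▸ h.strictAnti_angle.antitone hα.2, h.angle_zero ▸ h.strictAnti_angle.antitone hα.1⟩

theorem angle_mem_Ico (h : P.IsAngleParam ρ ζ v p q ℓ) {α : ℝ} (hα : α ∈ Ioc (0 : ℝ) 1) :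
    P.θ α ∈ Ico p q :=
  ⟨h.angle_one ▸ h.strictAnti_angle.antitone hα.2, h.angle_zero ▸ h.strictAnti_angle hα.1⟩

theorem angle_mem_Ioc (h : P.IsAngleParam ρ ζ v p q ℓ) {α : ℝ} (hα : α ∈ Ico (0 : ℝ) 1) :
    P.θ α ∈ Ioc p q :=
  ⟨h.angle_one ▸ h.strictAnti_angle hα.2, h.angle_zero ▸ h.strictAnti_angle.antitone hα.1⟩

theorem image_angle (h : P.IsAngleParam ρ ζ v p q ℓ) : P.θ '' Icc 0 1 = Icc p q := by
  apply Subset.antisymm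
  · rintro _ ⟨α, hα, rfl⟩
    exact h.angle_mem_Icc hα
  · have := intermediate_value_Icc' (zero_le_one' ℝ) h.continuous_angle.continuousOn
    rwa [h.angle_zero, h.angle_one] at this

theorem isGivenBy (h : P.IsAngleParam ρ ζ v p q ℓ) : P.IsGivenBy ρ ζ (Icc p q) :=
  ⟨h.image_angle, fun α _ => ⟨h.r_eq α, h.z_eq α⟩⟩

theorem dα_r (h : P.IsAngleParam ρ ζ v p q ℓ) {α : ℝ} (hα : α ∈ Icc (0 : ℝ) 1) :
    dα P.r α = ℓ * Real.cos (P.θ α) :=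
  dα_of_hasDerivAt hα (h.hasDerivAt_r α)

theorem dα_z (h : P.IsAngleParam ρ ζ v p q ℓ) {α : ℝ} (hα : α ∈ Icc (0 : ℝ) 1) :
    dα P.z α = ℓ * Real.sin (P.θ α) :=
  dα_of_hasDerivAt hα (h.hasDerivAt_z α)

theorem dα_dα_r (h : P.IsAngleParam ρ ζ v p q ℓ) {α : ℝ} (hα : α ∈ Icc (0 : ℝ) 1) :
    dα (dα P.r) α = ℓ * (-Real.sin (P.θ α) * (-ℓ / v (P.θ α))) := by
  rw [dα_congr (fun x hx => h.dα_r hx) hα]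
  exact dα_of_hasDerivAt hα ((h.hasDerivAt_angle α).cos.const_mul ℓ)

theorem dα_dα_z (h : P.IsAngleParam ρ ζ v p q ℓ) {α : ℝ} (hα : α ∈ Icc (0 : ℝ) 1) :
    dα (dα P.z) α = ℓ * (Real.cos (P.θ α) * (-ℓ / v (P.θ α))) := by
  rw [dα_congr (fun x hx => h.dα_z hx) hα]
  exact dα_of_hasDerivAt hα ((h.hasDerivAt_angle α).sin.const_mul ℓ)

theorem speed_eq (h : P.IsAngleParam ρ ζ v p q ℓ) {α : ℝ} (hα : α ∈ Icc (0 : ℝ) 1) :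
    P.speed α = ℓ := by
  rw [Profile.speed, h.dα_r hα, h.dα_z hα, mul_pow, mul_pow, ← mul_add, Real.cos_sq_add_sin_sq,
    mul_one, Real.sqrt_sq h.speed_pos.le]

theorem τr_eq (h : P.IsAngleParam ρ ζ v p q ℓ) {α : ℝ} (hα : α ∈ Icc (0 : ℝ) 1) :
    P.τr α = Real.cos (P.θ α) := by
  rw [Profile.τr, h.speed_eq hα, h.dα_r hα, mul_div_cancel_left₀ _ h.speed_pos.ne']

theorem τz_eq (h : P.IsAngleParam ρ ζ v p q ℓ) {α : ℝ} (hα : α ∈ Icc (0 : ℝ) 1) :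
    P.τz α = Real.sin (P.θ α) := by
  rw [Profile.τz, h.speed_eq hα, h.dα_z hα, mul_div_cancel_left₀ _ h.speed_pos.ne']

theorem H_eq (h : P.IsAngleParam ρ ζ v p q ℓ) {α : ℝ} (hα : α ∈ Icc (0 : ℝ) 1)
    (hr : 0 < P.r α) :
    P.H α = (Real.sin (P.θ α) / P.r α - 1 / v (P.θ α)) / 2 := by
  have hv := (h.v_pos α).ne'
  have hl := h.speed_pos.ne'
  have hr' := hr.ne'
  rw [Profile.H, h.speed_eq hα, h.dα_dα_r hα, h.dα_dα_z hα, h.dα_r hα, h.dα_z hα]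
  field_simp
  linear_combination -P.r α * Real.sin_sq_add_cos_sq (P.θ α)

theorem length_eq (h : P.IsAngleParam ρ ζ v p q ℓ) : P.length = ℓ := by
  rw [Profile.length, intervalIntegral.integral_congr (g := fun _ => ℓ)]
  · simp
  · intro α hα
    rw [uIcc_of_le zero_le_one] at hα
    exact h.speed_eq hα

theorem isNormalized (h : P.IsAngleParam ρ ζ v p q ℓ) (hp : -Real.pi < p) (hq : q ≤ Real.pi)
    (hinj : InjOn (fun θ => (ρ θ, ζ θ)) (Icc p q)) : P.IsNormalized where
  arclength α hα := by
    rw [h.dα_dα_r hα, h.dα_dα_z hα, h.dα_r hα, h.dα_z hα]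
    ring
  injective α hα α' hα' he := by
    simp only [h.r_eq, h.z_eq] at he
    exact h.strictAnti_angle.injective (hinj (h.angle_mem_Icc hα) (h.angle_mem_Icc hα') he)
  angle_mem α hα := ⟨hp.trans_le (h.angle_mem_Icc hα).1, (h.angle_mem_Icc hα).2.trans hq⟩
  cos_angle α hα := (h.τr_eq hα).symm
  sin_angle α hα := (h.τz_eq hα).symm

theorem isRegular_static (h : P.IsAngleParam ρ ζ v p q ℓ) (I : Set ℝ) : P.static.IsRegular I where
  contDiff_r := (h.contDiff_r.comp contDiff_fst).contDiffOn
  contDiff_z := (h.contDiff_z.comp contDiff_fst).contDiffOn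
  continuous_θ := (h.continuous_angle.comp continuous_fst).continuousOn

end Profile.IsAngleParam

theorem Profile.IsGivenBy.trace_eq {P : Profile} {ρ ζ : ℝ → ℝ} {I : Set ℝ}
    (h : P.IsGivenBy ρ ζ I) : P.trace = (fun θ => (ρ θ, ζ θ)) '' I := by
  rw [← h.1, image_image, Profile.trace]
  exact image_congr fun α hα => by rw [(h.2 α hα).1, (h.2 α hα).2]

/-- A smooth function bounded below by a positive constant has an antiderivative with smooth inverse. -/
theorem exists_contDiff_inverse_antideriv {v : ℝ → ℝ} {c : ℝ} (hc : 0 < c) (hcv : ∀ x, c ≤ v x)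
    (hv : ContDiff ℝ 4 v) (p : ℝ) :
    ∃ S φ : ℝ → ℝ, S p = 0 ∧ (∀ x, HasDerivAt S (v x) x) ∧ ContDiff ℝ 4 φ ∧
      (∀ x, φ (S x) = x) ∧ ∀ x, HasDerivAt φ (v (φ x))⁻¹ x := by
  have hv0 : ∀ x, 0 < v x := fun x => hc.trans_le (hcv x)
  set S : ℝ → ℝ := fun x => ∫ t in p..x, v t with hS
  have hderiv : ∀ x, HasDerivAt S (v x) x := fun x =>
    intervalIntegral.integral_hasDerivAt_right (hv.continuous.intervalIntegrable _ _)
      (hv.continuous.stronglyMeasurableAtFilter _ _) hv.continuous.continuousAt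
  have hmono : StrictMono S := strictMono_of_deriv_pos fun x => by
    rw [(hderiv x).deriv]; exact hv0 x
  have hcont : Continuous S := continuous_iff_continuousAt.2 fun x => (hderiv x).continuousAt
  have hlin : Monotone fun x => S x - c * x := by
    have hd : ∀ x, HasDerivAt (fun x => S x - c * x) (v x - c * 1) x := fun x =>
      (hderiv x).sub ((hasDerivAt_id x).const_mul c)
    refine monotone_of_deriv_nonneg (fun x => (hd x).differentiableAt) fun x => ?_
    rw [(hd x).deriv]
    linarith [hcv x]
  have hsurj : Function.Surjective S := by
    refine hcont.surjective ?_ ?_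
    · refine Filter.tendsto_atTop_mono' _ ?_
        (Filter.tendsto_atTop_add_const_left _ (S 0) (Filter.tendsto_id.const_mul_atTop hc))
      filter_upwards [Filter.eventually_ge_atTop 0] with x hx
      have := hlin hx
      simp only [id, mul_zero, sub_zero] at this ⊢
      linarith
    · refine Filter.tendsto_atBot_mono' _ ?_
        (Filter.tendsto_atBot_add_const_left _ (S 0) (Filter.tendsto_id.const_mul_atBot hc))
      filter_upwards [Filter.eventually_le_atBot 0] with x hx
      have := hlin hx
      simp only [id, mul_zero, sub_zero] at this ⊢
      linarith
  have hSc : ContDiff ℝ 4 S := by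
    have h5 : ContDiff ℝ (4 + 1) S := by
      refine contDiff_succ_iff_deriv.2 ⟨fun x => (hderiv x).differentiableAt, by simp, ?_⟩
      rwa [show deriv S = v from funext fun x => (hderiv x).deriv]
    exact h5.of_le le_self_add
  let e := (hmono.orderIsoOfSurjective S hsurj).toHomeomorph
  have he : ∀ x, e x = S x := fun x => rfl
  have heS : ∀ x, S (e.symm x) = x := fun x => e.apply_symm_apply x
  refine ⟨S, e.symm, by simp [hS], hderiv, ?_, fun x => e.symm_apply_apply x, fun x => ?_⟩
  · exact e.contDiff_symm_deriv (fun x => (hv0 x).ne') hderiv hSc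
  · exact HasDerivAt.of_local_left_inverse e.symm.continuous.continuousAt (hderiv _)
      (hv0 _).ne' (Filter.Eventually.of_forall heS)

/-- Reparametrization by arc length of a curve given in terms of its tangent angle. -/
theorem exists_isAngleParam {ρ ζ v : ℝ → ℝ} {p q c : ℝ} (hpq : p < q) (hc : 0 < c)
    (hcv : ∀ x, c ≤ v x) (hv : ContDiff ℝ 4 v) (hρc : ContDiff ℝ 4 ρ) (hζc : ContDiff ℝ 4 ζ)
    (hρ : ∀ x, HasDerivAt ρ (-v x * Real.cos x) x) (hζ : ∀ x, HasDerivAt ζ (-v x * Real.sin x) x) :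
    ∃ P : Profile, ∃ ℓ : ℝ, P.IsAngleParam ρ ζ v p q ℓ := by
  have hv0 : ∀ x, 0 < v x := fun x => hc.trans_le (hcv x)
  obtain ⟨S, φ, hSp, hS, hφc, hφS, hφ⟩ := exists_contDiff_inverse_antideriv hc hcv hv p
  have hmono : StrictMono S := strictMono_of_deriv_pos fun x => by
    rw [(hS x).deriv]; exact hv0 x
  let θ : ℝ → ℝ := fun α => φ (S q * (1 - α))
  have hθ : ∀ α, HasDerivAt θ (-S q / v (θ α)) α := fun α => by
    have h1 : HasDerivAt (fun α : ℝ => S q * (1 - α)) (S q * (0 - 1)) α :=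
      ((hasDerivAt_const α (1 : ℝ)).sub (hasDerivAt_id α)).const_mul (S q)
    exact ((hφ (S q * (1 - α))).comp α h1).congr_deriv (by simp only [θ]; ring)
  have hθc : ContDiff ℝ 4 θ := hφc.comp (contDiff_const.mul (contDiff_const.sub contDiff_id))
  refine ⟨⟨fun α => ρ (θ α), fun α => ζ (θ α), θ⟩, S q, ?_⟩
  exact
  { speed_pos := hSp ▸ hmono hpq
    contDiff_r := hρc.comp hθc
    contDiff_z := hζc.comp hθc
    angle_zero := by simp [θ, hφS]
    angle_one := by
      have := hφS p
      rw [hSp] at this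
      simp [θ, this]
    v_pos := fun α => hv0 _
    hasDerivAt_angle := hθ
    hasDerivAt_r := fun α => by
      have := (hv0 (θ α)).ne'
      exact ((hρ (θ α)).comp α (hθ α)).congr_deriv (by field_simp)
    hasDerivAt_z := fun α => by
      have := (hv0 (θ α)).ne'
      exact ((hζ (θ α)).comp α (hθ α)).congr_deriv (by field_simp)
    r_eq := fun α => rfl
    z_eq := fun α => rfl }

/-! ### Nodoids -/

/-- The root of the discriminant of the quadratic equation for the radius of the nodoid. -/
def nodD (lam a θ : ℝ) : ℝ := Real.sqrt (Real.sin θ ^ 2 + 4 * lam ^ 2 * a ^ 2)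

/-- Minus the derivative of the arc length of the nodoid with respect to the tangent angle. -/
def nodV (lam a θ : ℝ) : ℝ := nodR lam a θ / nodD lam a θ

section Nodoid

variable {lam a : ℝ}

theorem nodD_sq (lam a θ : ℝ) :
    nodD lam a θ ^ 2 = Real.sin θ ^ 2 + 4 * lam ^ 2 * a ^ 2 :=
  Real.sq_sqrt (by positivity)

theorem nodD_eq (hl : lam < 0) (a θ : ℝ) :
    nodD lam a θ = Real.sin θ - 2 * lam * nodR lam a θ := by
  have := hl.ne
  rw [nodR, nodD]
  field_simp
  ring

/-- The radius of the nodoid is a root of a quadratic equation. -/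
theorem sin_mul_nodR (hl : lam < 0) (a θ : ℝ) :
    Real.sin θ * nodR lam a θ = lam * (nodR lam a θ ^ 2 - a ^ 2) := by
  have h2 := nodD_sq lam a θ
  rw [nodD_eq hl] at h2
  refine mul_left_cancel₀ (a := 4 * lam) (by linarith) ?_
  linear_combination -h2

theorem nodD_pos (hl : lam < 0) (ha : 0 < a) (θ : ℝ) : 0 < nodD lam a θ := by
  have : 0 < lam ^ 2 := by nlinarith
  exact Real.sqrt_pos.2 (by positivity)

theorem abs_sin_lt_nodD (hl : lam < 0) (ha : 0 < a) (θ : ℝ) :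
    |Real.sin θ| < nodD lam a θ := by
  have : 0 < lam ^ 2 := by nlinarith
  refine abs_lt_of_sq_lt_sq ?_ (nodD_pos hl ha θ).le
  rw [nodD_sq]
  have : 0 < 4 * lam ^ 2 * a ^ 2 := by positivity
  linarith

theorem nodR_pos (hl : lam < 0) (ha : 0 < a) (θ : ℝ) : 0 < nodR lam a θ := by
  refine div_pos_of_neg_of_neg ?_ (by linarith)
  have := (abs_lt.1 (abs_sin_lt_nodD hl ha θ)).2
  rw [nodD] at this
  linarith

/-- A positive nodoid radius forces `λ < 0`. -/
theorem lam_neg_of_nodR_pos {θ : ℝ} (h : 0 < nodR lam a θ) : lam < 0 := by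
  by_contra! hl
  have : Real.sin θ ≤ Real.sqrt (Real.sin θ ^ 2 + 4 * lam ^ 2 * a ^ 2) :=
    Real.le_sqrt_of_sq_le (by nlinarith [sq_nonneg (lam * a)])
  exact h.not_ge (div_nonpos_of_nonpos_of_nonneg (by linarith) (by linarith))

/-- The degenerate nodoid with `a = 0` has zero radius at angles with nonnegative sine. -/
theorem pos_of_nodR_pos {θ : ℝ} (ha : 0 ≤ a) (hθ : 0 ≤ Real.sin θ) (h : 0 < nodR lam a θ) :
    0 < a := by
  refine lt_of_le_of_ne ha fun h0 => h.ne' ?_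
  rw [nodR, ← h0]
  simp [Real.sqrt_sq hθ]

theorem nodR_factor (hl : lam < 0) (ha : 0 < a) (θ x : ℝ) :
    lam * (x ^ 2 - a ^ 2) - Real.sin θ * x =
      lam * (x - nodR lam a θ) * (x + a ^ 2 / nodR lam a θ) := by
  have h := sin_mul_nodR hl a θ
  have hr := (nodR_pos hl ha θ).ne'
  field_simp
  linear_combination -x * h

theorem nodR_lt_iff (hl : lam < 0) (ha : 0 < a) {θ x : ℝ} (hx : 0 < x) :
    nodR lam a θ < x ↔ lam * (x ^ 2 - a ^ 2) < Real.sin θ * x := by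
  have hr := nodR_pos hl ha θ
  have hp : 0 < x + a ^ 2 / nodR lam a θ := by positivity
  rw [← sub_neg (a := lam * _), nodR_factor hl ha, mul_neg_iff]
  constructor
  · intro h
    exact Or.inr ⟨mul_neg_of_neg_of_pos hl (by linarith), hp⟩
  · rintro (h | h)
    · linarith
    · by_contra! hc
      nlinarith

theorem nodR_eq_iff (hl : lam < 0) (ha : 0 < a) {θ x : ℝ} (hx : 0 < x) :
    nodR lam a θ = x ↔ lam * (x ^ 2 - a ^ 2) = Real.sin θ * x := by
  have hr := nodR_pos hl ha θ
  have hp : 0 < x + a ^ 2 / nodR lam a θ := by positivity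
  rw [← sub_eq_zero (a := lam * _), nodR_factor hl ha, mul_eq_zero, mul_eq_zero, sub_eq_zero]
  constructor
  · intro h
    exact Or.inl (Or.inr h.symm)
  · rintro ((h | h) | h)
    · linarith
    · exact h.symm
    · linarith

theorem le_nodR_iff (hl : lam < 0) (ha : 0 < a) {θ x : ℝ} (hx : 0 < x) :
    x ≤ nodR lam a θ ↔ Real.sin θ * x ≤ lam * (x ^ 2 - a ^ 2) := by
  rw [← not_lt, nodR_lt_iff hl ha hx, not_lt]

theorem nodR_le_iff (hl : lam < 0) (ha : 0 < a) {θ x : ℝ} (hx : 0 < x) :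
    nodR lam a θ ≤ x ↔ lam * (x ^ 2 - a ^ 2) ≤ Real.sin θ * x := by
  rw [le_iff_lt_or_eq, le_iff_lt_or_eq, nodR_lt_iff hl ha hx, nodR_eq_iff hl ha hx]

theorem nodR_le_self (hl : lam < 0) (ha : 0 < a) {θ : ℝ} (hθ : 0 ≤ Real.sin θ) :
    nodR lam a θ ≤ a := by
  rw [nodR_le_iff hl ha ha, sub_self, mul_zero]
  positivity

theorem lt_nodR_of_sin_neg (hl : lam < 0) (ha : 0 < a) {θ : ℝ} (hθ : Real.sin θ < 0) :
    a < nodR lam a θ := by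
  have h : a ≤ nodR lam a θ := by
    rw [le_nodR_iff hl ha ha]
    nlinarith
  refine lt_of_le_of_ne h fun he => ?_
  have := (nodR_eq_iff hl ha ha).1 he.symm
  nlinarith

theorem nodR_zero (hl : lam < 0) (ha : 0 < a) : nodR lam a 0 = a := by
  rw [nodR_eq_iff hl ha ha]
  simp

theorem contDiff_nodD (hl : lam < 0) (ha : 0 < a) : ContDiff ℝ 4 (nodD lam a) := by
  refine ((Real.contDiff_sin.pow 2).add contDiff_const).sqrt fun θ => ?_
  have : 0 < lam ^ 2 := by nlinarith
  positivity

theorem contDiff_nodR (hl : lam < 0) (ha : 0 < a) : ContDiff ℝ 4 (nodR lam a) :=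
  (Real.contDiff_sin.sub (contDiff_nodD hl ha)).div_const _

theorem contDiff_nodV (hl : lam < 0) (ha : 0 < a) : ContDiff ℝ 4 (nodV lam a) :=
  (contDiff_nodR hl ha).div (contDiff_nodD hl ha) fun θ => (nodD_pos hl ha θ).ne'

theorem nodV_pos (hl : lam < 0) (ha : 0 < a) (θ : ℝ) : 0 < nodV lam a θ :=
  div_pos (nodR_pos hl ha θ) (nodD_pos hl ha θ)

theorem exists_pos_le_nodV (hl : lam < 0) (ha : 0 < a) : ∃ c > 0, ∀ θ, c ≤ nodV lam a θ := by
  obtain ⟨x, -, hx⟩ := isCompact_Icc.exists_isMinOn (nonempty_Icc.2 Real.two_pi_pos.le)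
    (contDiff_nodV hl ha).continuous.continuousOn
  refine ⟨nodV lam a x, nodV_pos hl ha x, fun θ => ?_⟩
  have hper : Function.Periodic (nodV lam a) (2 * Real.pi) := fun θ => by
    simp only [nodV, nodR, nodD, Real.sin_add_two_pi]
  obtain ⟨y, hy, hθy⟩ := hper.exists_mem_Ico₀ Real.two_pi_pos θ
  rw [hθy]
  exact hx (Ico_subset_Icc_self hy)

theorem hasDerivAt_nodD (hl : lam < 0) (ha : 0 < a) (θ : ℝ) :
    HasDerivAt (nodD lam a) (Real.sin θ * Real.cos θ / nodD lam a θ) θ := by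
  have hD := nodD_pos hl ha θ
  have h0 : Real.sin θ ^ 2 + 4 * lam ^ 2 * a ^ 2 ≠ 0 := by
    rw [← nodD_sq]
    positivity
  refine ((((Real.hasDerivAt_sin θ).pow 2).add_const (4 * lam ^ 2 * a ^ 2)).sqrt h0).congr_deriv ?_
  simp only [nodD, Pi.pow_apply, Nat.cast_ofNat, Nat.add_one_sub_one, pow_one]
  ring

theorem hasDerivAt_nodR (hl : lam < 0) (ha : 0 < a) (θ : ℝ) :
    HasDerivAt (nodR lam a) (-nodV lam a θ * Real.cos θ) θ := by
  have hD := (nodD_pos hl ha θ).ne'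
  have h2 := hl.ne
  refine (((Real.hasDerivAt_sin θ).sub (hasDerivAt_nodD hl ha θ)).div_const (2 * lam)).congr_deriv ?_
  have h1 := nodD_eq hl a θ
  rw [nodV]
  field_simp
  linear_combination Real.cos θ * h1

theorem hasDerivAt_nodZ (hl : lam < 0) (ha : 0 < a) (θ₀ z₀ θ : ℝ) :
    HasDerivAt (nodZ lam a θ₀ z₀) (-nodV lam a θ * Real.sin θ) θ := by
  have hD := (nodD_pos hl ha θ).ne'
  have h2 := hl.ne
  have hc : Continuous fun x => Real.sin x ^ 2 / nodD lam a x - Real.sin x :=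
    ((Real.continuous_sin.pow 2).div (contDiff_nodD hl ha).continuous
      fun x => (nodD_pos hl ha x).ne').sub Real.continuous_sin
  refine (((intervalIntegral.integral_hasDerivAt_right (hc.intervalIntegrable θ₀ θ)
    (hc.stronglyMeasurableAtFilter _ _) hc.continuousAt).const_mul
      (-1 / (2 * lam))).add_const z₀).congr_deriv ?_
  have h1 := nodD_eq hl a θ
  rw [nodV]
  field_simp
  linear_combination Real.sin θ * h1

theorem nodZ_self (lam a θ₀ z₀ : ℝ) : nodZ lam a θ₀ z₀ θ₀ = z₀ := by
  simp [nodZ]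

theorem contDiff_nodZ (hl : lam < 0) (ha : 0 < a) (θ₀ z₀ : ℝ) :
    ContDiff ℝ 4 (nodZ lam a θ₀ z₀) := by
  have h5 : ContDiff ℝ (4 + 1) (nodZ lam a θ₀ z₀) := by
    refine contDiff_succ_iff_deriv.2
      ⟨fun x => (hasDerivAt_nodZ hl ha θ₀ z₀ x).differentiableAt, by simp, ?_⟩
    rw [show deriv (nodZ lam a θ₀ z₀) = fun θ => -nodV lam a θ * Real.sin θ from
      funext fun x => (hasDerivAt_nodZ hl ha θ₀ z₀ x).deriv]
    exact (contDiff_nodV hl ha).neg.mul Real.contDiff_sin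
  exact h5.of_le le_self_add

theorem strictMonoOn_nodZ (hl : lam < 0) (ha : 0 < a) (θ₀ z₀ : ℝ) :
    StrictMonoOn (nodZ lam a θ₀ z₀) (Icc (-Real.pi) 0) := by
  refine strictMonoOn_of_deriv_pos (convex_Icc _ _)
    (contDiff_nodZ hl ha θ₀ z₀).continuous.continuousOn fun x hx => ?_
  rw [interior_Icc] at hx
  rw [(hasDerivAt_nodZ hl ha θ₀ z₀ x).deriv]
  exact mul_pos_of_neg_of_neg (neg_lt_zero.2 (nodV_pos hl ha x))
    (Real.sin_neg_of_neg_of_neg_pi_lt hx.2 hx.1)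

theorem strictAntiOn_nodZ (hl : lam < 0) (ha : 0 < a) (θ₀ z₀ : ℝ) :
    StrictAntiOn (nodZ lam a θ₀ z₀) (Icc 0 Real.pi) := by
  refine strictAntiOn_of_deriv_neg (convex_Icc _ _)
    (contDiff_nodZ hl ha θ₀ z₀).continuous.continuousOn fun x hx => ?_
  rw [interior_Icc] at hx
  rw [(hasDerivAt_nodZ hl ha θ₀ z₀ x).deriv]
  exact mul_neg_of_neg_of_pos (neg_lt_zero.2 (nodV_pos hl ha x))
    (Real.sin_pos_of_mem_Ioo hx)

/-- One period of the nodoid has no self-intersections. -/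
theorem injOn_nodoid (hl : lam < 0) (ha : 0 < a) (θ₀ z₀ : ℝ) :
    InjOn (fun θ => (nodR lam a θ, nodZ lam a θ₀ z₀ θ)) (Ioc (-Real.pi) Real.pi) := by
  have key : ∀ x y, x ∈ Ioc (-Real.pi) Real.pi → y ∈ Ioc (-Real.pi) Real.pi → x ≤ y →
      nodR lam a x = nodR lam a y → nodZ lam a θ₀ z₀ x = nodZ lam a θ₀ z₀ y → x = y := by
    intro x y hx hy hxy hr hz
    rcases le_or_gt 0 x with h0 | h0
    · exact (strictAntiOn_nodZ hl ha θ₀ z₀).injOn ⟨h0, hx.2⟩ ⟨h0.trans hxy, hy.2⟩ hz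
    rcases le_or_gt y 0 with h1 | h1
    · exact (strictMonoOn_nodZ hl ha θ₀ z₀).injOn ⟨hx.1.le, h0.le⟩ ⟨hy.1.le, h1⟩ hz
    have h2 := lt_nodR_of_sin_neg hl ha (Real.sin_neg_of_neg_of_neg_pi_lt h0 hx.1)
    have h3 := nodR_le_self hl ha (Real.sin_nonneg_of_nonneg_of_le_pi h1.le hy.2)
    linarith
  intro x hx y hy h
  simp only [Prod.mk.injEq] at h
  rcases le_total x y with hxy | hxy
  · exact key x y hx hy hxy h.1 h.2
  · exact (key y x hy hx hxy h.1.symm h.2.symm).symm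

theorem exists_isAngleParam_nodoid (hl : lam < 0) (ha : 0 < a) (θ₀ z₀ : ℝ) {p q : ℝ}
    (hpq : p < q) : ∃ P : Profile, ∃ ℓ : ℝ,
      P.IsAngleParam (nodR lam a) (nodZ lam a θ₀ z₀) (nodV lam a) p q ℓ := by
  obtain ⟨c, hc, hcv⟩ := exists_pos_le_nodV hl ha
  exact exists_isAngleParam hpq hc hcv (contDiff_nodV hl ha) (contDiff_nodR hl ha)
    (contDiff_nodZ hl ha θ₀ z₀) (hasDerivAt_nodR hl ha) (hasDerivAt_nodZ hl ha θ₀ z₀)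

/-- The nodoid has constant mean curvature `λ`. -/
theorem Profile.IsAngleParam.H_eq_lam {P : Profile} {ζ : ℝ → ℝ} {p q ℓ : ℝ} (hl : lam < 0)
    (ha : 0 < a) (h : P.IsAngleParam (nodR lam a) ζ (nodV lam a) p q ℓ) {α : ℝ}
    (hα : α ∈ Icc (0 : ℝ) 1) : P.H α = lam := by
  have hr := nodR_pos hl ha (P.θ α)
  rw [h.H_eq hα (by rwa [h.r_eq]), h.r_eq, nodV, nodD_eq hl]
  field_simp
  ring

end Nodoid

/-! ### Catenoids -/

section Catenoid

variable {A : ℝ}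

theorem hasDerivAt_catR {θ : ℝ} (hθ : 0 < Real.sin θ) :
    HasDerivAt (catR A) (-(A / Real.sin θ ^ 2) * Real.cos θ) θ := by
  refine ((hasDerivAt_const θ A).div (Real.hasDerivAt_sin θ) hθ.ne').congr_deriv ?_
  ring

theorem one_add_cos_pos {θ : ℝ} (hθ : 0 < Real.sin θ) : 0 < 1 + Real.cos θ := by
  refine lt_of_le_of_ne (by linarith [Real.neg_one_le_cos θ]) fun h => ?_
  nlinarith [Real.sin_sq_add_cos_sq θ]

theorem hasDerivAt_catZ {θ : ℝ} (hθ : 0 < Real.sin θ) :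
    HasDerivAt (catZ A) (-(A / Real.sin θ ^ 2) * Real.sin θ) θ := by
  have hc := (one_add_cos_pos hθ).ne'
  have hs := hθ.ne'
  refine (((((Real.hasDerivAt_cos θ).const_add 1).div (Real.hasDerivAt_sin θ) hs).log
    (div_ne_zero hc hs)).const_mul A).congr_deriv ?_
  rw [Pi.div_apply]
  field_simp
  linear_combination (-A) * Real.sin_sq_add_cos_sq θ

theorem catR_eq_cosh (hA : 0 < A) {θ : ℝ} (hθ : 0 < Real.sin θ) :
    catR A θ = A * Real.cosh (catZ A θ / A) := by
  have hc := one_add_cos_pos hθ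
  rw [catZ, mul_div_cancel_left₀ _ hA.ne', Real.cosh_log (div_pos hc hθ), catR, inv_div]
  field_simp
  linear_combination -Real.sin_sq_add_cos_sq θ

theorem catZ_pi_div_two (A : ℝ) : catZ A (Real.pi / 2) = 0 := by
  simp [catZ]

theorem catR_pi_div_two (A : ℝ) : catR A (Real.pi / 2) = A := by
  simp [catR]

theorem strictAntiOn_catZ (hA : 0 < A) : StrictAntiOn (catZ A) (Ioo 0 Real.pi) := by
  refine strictAntiOn_of_deriv_neg (convex_Ioo _ _) (fun θ hθ =>
    (hasDerivAt_catZ (Real.sin_pos_of_mem_Ioo hθ)).continuousAt.continuousWithinAt) fun θ hθ => ?_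
  rw [interior_Ioo] at hθ
  have hs := Real.sin_pos_of_mem_Ioo hθ
  rw [(hasDerivAt_catZ hs).deriv]
  have : 0 < A / Real.sin θ ^ 2 * Real.sin θ := by positivity
  linarith

/-- The catenary starting at its vertex, of length `σ`, parametrized proportionally to arc length. -/
def catenary (A σ : ℝ) : Profile :=
  ⟨fun α => catR A (Real.pi / 2 - Real.arctan (σ / A * α)),
    fun α => catZ A (Real.pi / 2 - Real.arctan (σ / A * α)),
    fun α => Real.pi / 2 - Real.arctan (σ / A * α)⟩

theorem sin_catenary_angle_pos (A σ α : ℝ) : 0 < Real.sin ((catenary A σ).θ α) := by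
  change 0 < Real.sin (Real.pi / 2 - Real.arctan (σ / A * α))
  rw [Real.sin_pi_div_two_sub]
  exact Real.cos_arctan_pos _

theorem hasDerivAt_catenary_angle (hA : 0 < A) (σ α : ℝ) :
    HasDerivAt (catenary A σ).θ (-σ / (A / Real.sin ((catenary A σ).θ α) ^ 2)) α := by
  have h1 : HasDerivAt (fun α => σ / A * α) (σ / A * 1) α := (hasDerivAt_id α).const_mul _
  refine (h1.arctan.const_sub (Real.pi / 2)).congr_deriv ?_
  change _ = -σ / (A / Real.sin (Real.pi / 2 - Real.arctan (σ / A * α)) ^ 2)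
  rw [Real.sin_pi_div_two_sub, Real.cos_sq_arctan]
  field_simp

theorem isAngleParam_catenary {σ : ℝ} (hA : 0 < A) (hσ : 0 < σ) :
    (catenary A σ).IsAngleParam (catR A) (catZ A) (fun θ => A / Real.sin θ ^ 2)
      (Real.pi / 2 - Real.arctan (σ / A)) (Real.pi / 2) σ := by
  have hs := sin_catenary_angle_pos A σ
  have hθc : ContDiff ℝ 4 (catenary A σ).θ :=
    contDiff_const.sub (Real.contDiff_arctan.comp (contDiff_const.mul contDiff_id))
  exact
  { speed_pos := hσ
    contDiff_r := contDiff_const.div (Real.contDiff_sin.comp hθc) fun α => (hs α).ne'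
    contDiff_z := contDiff_const.mul (((contDiff_const.add (Real.contDiff_cos.comp hθc)).div
      (Real.contDiff_sin.comp hθc) fun α => (hs α).ne').log
        fun α => (div_pos (one_add_cos_pos (hs α)) (hs α)).ne')
    angle_zero := by simp [catenary]
    angle_one := by simp [catenary]
    v_pos := fun α => div_pos hA (pow_pos (hs α) 2)
    hasDerivAt_angle := hasDerivAt_catenary_angle hA σ
    hasDerivAt_r := fun α => by
      have := (hs α).ne'
      exact ((hasDerivAt_catR (hs α)).comp α (hasDerivAt_catenary_angle hA σ α)).congr_deriv
        (by field_simp)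
    hasDerivAt_z := fun α => by
      have := (hs α).ne'
      exact ((hasDerivAt_catZ (hs α)).comp α (hasDerivAt_catenary_angle hA σ α)).congr_deriv
        (by field_simp)
    r_eq := fun α => rfl
    z_eq := fun α => rfl }

/-- The catenoid is a minimal surface. -/
theorem Profile.IsAngleParam.H_eq_zero {P : Profile} {ζ : ℝ → ℝ} {p q ℓ : ℝ} (hA : 0 < A)
    (h : P.IsAngleParam (catR A) ζ (fun θ => A / Real.sin θ ^ 2) p q ℓ) {α : ℝ}
    (hα : α ∈ Icc (0 : ℝ) 1) (hs : 0 < Real.sin (P.θ α)) : P.H α = 0 := by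
  rw [h.H_eq hα (by rw [h.r_eq]; exact div_pos hA hs), h.r_eq, catR]
  field_simp
  ring

end Catenoid

/-! ### The parameters at the triple junction -/

section Parameters

variable {A σ β : ℝ}

theorem mem_Ω₀_iff : (A, σ) ∈ Ω₀ ↔ 0 < A ∧ 0 < σ ∧ A ^ 2 + σ ^ 2 < 1 := by
  simp only [Ω₀, mem_ofPred_eq]
  constructor
  · rintro ⟨h1, -, h3, h4⟩
    have := (Real.lt_sqrt h3.le).1 h4
    exact ⟨h1, h3, by linarith⟩
  · rintro ⟨h1, h2, h3⟩
    exact ⟨h1, by nlinarith, h2, (Real.lt_sqrt h2.le).2 (by linarith)⟩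

theorem rBar_sq (A σ : ℝ) : rBar A σ ^ 2 = A ^ 2 + σ ^ 2 := by
  rw [rBar, Real.sq_sqrt (by positivity), add_comm]

theorem rBar_pos (hA : 0 < A) (σ : ℝ) : 0 < rBar A σ :=
  Real.sqrt_pos.2 (by positivity)

theorem rBar_lt_one (h : A ^ 2 + σ ^ 2 < 1) : rBar A σ < 1 := by
  rw [rBar, Real.sqrt_lt' one_pos]
  linarith

theorem sin_θBar₃ (hA : 0 < A) (σ : ℝ) : Real.sin (θBar₃ A (rBar A σ)) = A / rBar A σ := by
  have hr := rBar_pos hA σ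
  have h1 := rBar_sq A σ
  refine Real.sin_arcsin (by linarith [div_pos hA hr]) ((div_le_one hr).2 ?_)
  exact abs_le_of_sq_le_sq' (by nlinarith) hr.le |>.2

theorem cos_θBar₃ (hA : 0 < A) (hσ : 0 < σ) : Real.cos (θBar₃ A (rBar A σ)) = σ / rBar A σ := by
  have hr := rBar_pos hA σ
  have h1 := rBar_sq A σ
  rw [θBar₃, Real.cos_arcsin, ← Real.sqrt_sq (div_pos hσ hr).le]
  congr 1
  field_simp
  linarith

theorem θBar₃_mem (hA : 0 < A) (hσ : 0 < σ) :
    θBar₃ A (rBar A σ) ∈ Ioo 0 (Real.pi / 2) := by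
  have hr := rBar_pos hA σ
  have h1 := rBar_sq A σ
  refine ⟨Real.arcsin_pos.2 (div_pos hA hr), Real.arcsin_lt_pi_div_two.2 ((div_lt_one hr).2 ?_)⟩
  exact abs_lt_of_sq_lt_sq' (by nlinarith) hr.le |>.2

theorem θBar₃_eq_arctan (hA : 0 < A) (hσ : 0 < σ) :
    Real.pi / 2 - Real.arctan (σ / A) = θBar₃ A (rBar A σ) := by
  have hr := (rBar_pos hA σ).ne'
  have h := θBar₃_mem hA hσ
  have h1 : σ / A = Real.tan (Real.pi / 2 - θBar₃ A (rBar A σ)) := by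
    rw [Real.tan_pi_div_two_sub, Real.tan_eq_sin_div_cos, sin_θBar₃ hA, cos_θBar₃ hA hσ]
    field_simp
  rw [h1, Real.arctan_tan] <;> linarith [h.1, h.2]

theorem zBar_eq_catZ (hA : 0 < A) (hσ : 0 < σ) :
    zBar A (rBar A σ) = catZ A (θBar₃ A (rBar A σ)) := by
  have hr := rBar_pos hA σ
  have h1 := rBar_sq A σ
  rw [zBar, catZ, sin_θBar₃ hA, cos_θBar₃ hA hσ, Real.arcosh]
  have h2 : Real.sqrt ((rBar A σ / A) ^ 2 - 1) = σ / A := by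
    rw [← Real.sqrt_sq (div_pos hσ hA).le]
    congr 1
    field_simp
    linarith
  rw [h2]
  congr 2
  field_simp

theorem catR_θBar₃ (hA : 0 < A) (σ : ℝ) : catR A (θBar₃ A (rBar A σ)) = rBar A σ := by
  have hr := rBar_pos hA σ
  rw [catR, sin_θBar₃ hA]
  field_simp

theorem zBar_pos (hA : 0 < A) (hσ : 0 < σ) : 0 < zBar A (rBar A σ) := by
  have h := θBar₃_mem hA hσ
  rw [zBar_eq_catZ hA hσ, ← catZ_pi_div_two A]
  exact strictAntiOn_catZ hA ⟨h.1, by linarith [h.2, Real.pi_pos]⟩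
    ⟨by linarith [Real.pi_pos], by linarith [Real.pi_pos]⟩ h.2

theorem sin_θBar₂ (hA : 0 < A) (hσ : 0 < σ) (β : ℝ) :
    Real.sin (θBar₂ A (rBar A σ) β) * rBar A σ = -(A * Real.cos β + σ * Real.sin β) := by
  have hr := (rBar_pos hA σ).ne'
  rw [θBar₂, show θBar₃ A (rBar A σ) - Real.pi + β = θBar₃ A (rBar A σ) + β - Real.pi by ring,
    Real.sin_sub_pi, Real.sin_add, sin_θBar₃ hA, cos_θBar₃ hA hσ]
  field_simp

theorem sin_θBar₁ (hA : 0 < A) (hσ : 0 < σ) (β : ℝ) :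
    Real.sin (θBar₁ A (rBar A σ) β) * rBar A σ = A * Real.cos β - σ * Real.sin β := by
  have hr := (rBar_pos hA σ).ne'
  rw [θBar₁, Real.sin_sub, sin_θBar₃ hA, cos_θBar₃ hA hσ]
  field_simp

theorem lamOf_mul (hA : 0 < A) (hσ : 0 < σ) (h1 : A ^ 2 + σ ^ 2 < 1) (β : ℝ) :
    lamOf A σ β * (rBar A σ ^ 2 - 1 ^ 2) = Real.sin (θBar₂ A (rBar A σ) β) * rBar A σ := by
  have h : 1 - A ^ 2 - σ ^ 2 ≠ 0 := by linarith
  rw [sin_θBar₂ hA hσ, rBar_sq, lamOf]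
  field_simp
  ring

/-- The junction condition on the outer surface determines `λ`. -/
theorem eq_lamOf (hA : 0 < A) (hσ : 0 < σ) (h1 : A ^ 2 + σ ^ 2 < 1) {lam : ℝ}
    (h : lam * (rBar A σ ^ 2 - 1 ^ 2) = Real.sin (θBar₂ A (rBar A σ) β) * rBar A σ) :
    lam = lamOf A σ β := by
  refine mul_right_cancel₀ (b := rBar A σ ^ 2 - 1 ^ 2) ?_ (h.trans (lamOf_mul hA hσ h1 β).symm)
  rw [rBar_sq]
  linarith

theorem lamOf_neg_iff (h1 : A ^ 2 + σ ^ 2 < 1) :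
    lamOf A σ β < 0 ↔ A * Real.cos β + σ * Real.sin β < 0 := by
  rw [lamOf, div_lt_iff₀ (by linarith), zero_mul]

theorem lamOf_mul_aOf_sq (h1 : A ^ 2 + σ ^ 2 < 1) (hl : lamOf A σ β < 0)
    (ha : 0 < aOf A σ β) : lamOf A σ β * aOf A σ β ^ 2 * (1 - A ^ 2 - σ ^ 2) =
      (2 * A ^ 2 + 2 * σ ^ 2 - 1) * A * Real.cos β + σ * Real.sin β := by
  have hd := ((lamOf_neg_iff h1).1 hl).ne
  have h : 1 - A ^ 2 - σ ^ 2 ≠ 0 := by linarith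
  rw [aOf, Real.sq_sqrt (Real.sqrt_pos.1 ha).le, lamOf]
  field_simp

theorem lamOf_mul_one_sub (h1 : A ^ 2 + σ ^ 2 < 1) (hl : lamOf A σ β < 0)
    (ha : 0 < aOf A σ β) : lamOf A σ β * (1 - aOf A σ β ^ 2) = 2 * A * Real.cos β := by
  have h : 1 - A ^ 2 - σ ^ 2 ≠ 0 := by linarith
  refine mul_right_cancel₀ h ?_
  have h2 := lamOf_mul_aOf_sq h1 hl ha
  have h3 : lamOf A σ β * (1 - A ^ 2 - σ ^ 2) = A * Real.cos β + σ * Real.sin β := by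
    rw [lamOf]
    field_simp
  linear_combination h3 - h2

theorem lamOf_mul_sub (hA : 0 < A) (hσ : 0 < σ) (h1 : A ^ 2 + σ ^ 2 < 1) (hl : lamOf A σ β < 0)
    (ha : 0 < aOf A σ β) : lamOf A σ β * (rBar A σ ^ 2 - aOf A σ β ^ 2) =
      Real.sin (θBar₁ A (rBar A σ) β) * rBar A σ := by
  have h2 := lamOf_mul_one_sub h1 hl ha
  have h3 := lamOf_mul hA hσ h1 β
  rw [sin_θBar₂ hA hσ] at h3
  rw [sin_θBar₁ hA hσ]
  linear_combination h2 + h3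

/-- The junction condition on the inner surface determines `a`. -/
theorem eq_aOf (hA : 0 < A) (hσ : 0 < σ) (h1 : A ^ 2 + σ ^ 2 < 1) (hl : lamOf A σ β < 0)
    {a : ℝ} (ha : 0 ≤ a) (h : lamOf A σ β * (rBar A σ ^ 2 - a ^ 2) =
      Real.sin (θBar₁ A (rBar A σ) β) * rBar A σ) : a = aOf A σ β := by
  have hd := ((lamOf_neg_iff h1).1 hl).ne
  have h3 := lamOf_mul hA hσ h1 β
  rw [sin_θBar₂ hA hσ] at h3
  rw [sin_θBar₁ hA hσ] at h
  have h4 : lamOf A σ β * (1 - A ^ 2 - σ ^ 2) = A * Real.cos β + σ * Real.sin β := by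
    rw [rBar_sq] at h3
    linear_combination -h3
  rw [aOf, ← Real.sqrt_sq ha]
  congr 1
  rw [eq_div_iff hd]
  rw [rBar_sq] at h
  linear_combination (1 - A ^ 2 - σ ^ 2) * (-h) + (A ^ 2 + σ ^ 2 - a ^ 2) * h4

theorem tan_gt_iff (hσ : 0 < σ) (hc : Real.cos β < 0) :
    Real.tan β > A / σ * (1 - 2 * A ^ 2 - 2 * σ ^ 2) ↔
      (2 * A ^ 2 + 2 * σ ^ 2 - 1) * A * Real.cos β + σ * Real.sin β < 0 := by
  rw [Real.tan_eq_sin_div_cos, gt_iff_lt, lt_div_iff_of_neg hc, div_mul_eq_mul_div,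
    div_mul_eq_mul_div, lt_div_iff₀ hσ]
  constructor <;> intro h <;> linarith

theorem cos_neg_of_mem (hβ : β ∈ Ioo (Real.pi / 2) Real.pi) : Real.cos β < 0 :=
  Real.cos_neg_of_pi_div_two_lt_of_lt hβ.1 (by linarith [hβ.2, Real.pi_pos])

/-- The first constraint makes `λ` negative and `a` positive. -/
theorem params_of_tan_gt (hA : 0 < A) (hσ : 0 < σ) (h1 : A ^ 2 + σ ^ 2 < 1)
    (hβ : β ∈ Ioo (Real.pi / 2) Real.pi)
    (h : Real.tan β > A / σ * (1 - 2 * A ^ 2 - 2 * σ ^ 2)) :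
    lamOf A σ β < 0 ∧ 0 < aOf A σ β := by
  have hc := cos_neg_of_mem hβ
  have h2 := (tan_gt_iff hσ hc).1 h
  have h3 : A * Real.cos β + σ * Real.sin β < 0 := by
    nlinarith [mul_neg_of_pos_of_neg hA hc]
  exact ⟨(lamOf_neg_iff h1).2 h3, Real.sqrt_pos.2 (div_pos_of_neg_of_neg h2 h3)⟩

theorem tan_gt_of_params (hσ : 0 < σ) (h1 : A ^ 2 + σ ^ 2 < 1)
    (hβ : β ∈ Ioo (Real.pi / 2) Real.pi) (hl : lamOf A σ β < 0) (ha : 0 < aOf A σ β) :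
    Real.tan β > A / σ * (1 - 2 * A ^ 2 - 2 * σ ^ 2) := by
  have hc := cos_neg_of_mem hβ
  have h3 := (lamOf_neg_iff h1).1 hl
  refine (tan_gt_iff hσ hc).2 ?_
  have h4 := Real.sqrt_pos.1 ha
  by_contra! h5
  exact h4.not_ge (div_nonpos_of_nonneg_of_nonpos h5 h3.le)

theorem aOf_lt_one (hA : 0 < A) (h1 : A ^ 2 + σ ^ 2 < 1)
    (hβ : β ∈ Ioo (Real.pi / 2) Real.pi) (hl : lamOf A σ β < 0) (ha : 0 < aOf A σ β) :
    aOf A σ β < 1 := by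
  have hc := cos_neg_of_mem hβ
  have h2 := lamOf_mul_one_sub h1 hl ha
  have h3 : 2 * A * Real.cos β < 0 := mul_neg_of_pos_of_neg (by linarith) hc
  by_contra! h4
  have h5 : 0 ≤ lamOf A σ β * (1 - aOf A σ β ^ 2) :=
    mul_nonneg_of_nonpos_of_nonpos hl.le (by nlinarith)
  linarith

theorem θBar₁_mem (hA : 0 < A) (hσ : 0 < σ) (hβ : β ∈ Ioo (Real.pi / 2) Real.pi) :
    θBar₁ A (rBar A σ) β ∈ Ioo (-Real.pi) 0 := by
  have h := θBar₃_mem hA hσ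
  rw [θBar₁]
  constructor <;> linarith [h.1, h.2, hβ.1, hβ.2]

theorem θBar₂_mem (hA : 0 < A) (hσ : 0 < σ) (h1 : A ^ 2 + σ ^ 2 < 1)
    (hβ : β ∈ Ioo (Real.pi / 2) Real.pi) (hl : lamOf A σ β < 0) :
    θBar₂ A (rBar A σ) β ∈ Ioo 0 (θBar₃ A (rBar A σ)) := by
  have h := θBar₃_mem hA hσ
  have hr := rBar_pos hA σ
  refine ⟨?_, by rw [θBar₂]; linarith [hβ.2]⟩
  by_contra! h2
  have h3 : Real.sin (θBar₂ A (rBar A σ) β) ≤ 0 :=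
    Real.sin_nonpos_of_nonpos_of_neg_pi_le h2 (by rw [θBar₂]; linarith [h.1, hβ.1, Real.pi_pos])
  have h4 := sin_θBar₂ hA hσ β
  have h5 := (lamOf_neg_iff h1).1 hl
  nlinarith

theorem cos_lt_iff_θBar₁_lt (hA : 0 < A) (hσ : 0 < σ) (hβ : β ∈ Ioo (Real.pi / 2) Real.pi) :
    Real.cos β < -A / Real.sqrt (σ ^ 2 + A ^ 2) ↔ θBar₁ A (rBar A σ) β < -(Real.pi / 2) := by
  have h := θBar₃_mem hA hσ
  have h2 : -A / Real.sqrt (σ ^ 2 + A ^ 2) = Real.cos (θBar₃ A (rBar A σ) + Real.pi / 2) := by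
    rw [Real.cos_add_pi_div_two, sin_θBar₃ hA, rBar]
    ring
  rw [h2, Real.strictAntiOn_cos.lt_iff_gt ⟨by linarith [hβ.1, Real.pi_pos], hβ.2.le⟩
    ⟨by linarith [h.1, Real.pi_pos], by linarith [h.2]⟩, θBar₁]
  constructor <;> intro h <;> linarith

theorem cos_lt_neg_inv_iff (hA : 0 < A) : Real.cos β < -1 / (2 * A) ↔ 2 * A * Real.cos β < -1 := by
  rw [lt_div_iff₀ (by linarith), mul_comm]

/-- The inner surface stays inside the unit cylinder at the angle `θ`. -/
theorem nodR_lt_one_iff (h1 : A ^ 2 + σ ^ 2 < 1) (hl : lamOf A σ β < 0)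
    (ha : 0 < aOf A σ β) {θ : ℝ} :
    nodR (lamOf A σ β) (aOf A σ β) θ < 1 ↔ 2 * A * Real.cos β < Real.sin θ := by
  rw [nodR_lt_iff hl ha one_pos, one_pow, lamOf_mul_one_sub h1 hl ha, mul_one]

end Parameters

/-! ### The explicit curves form a steady state -/

section Separation

variable {lam a : ℝ}

theorem hasDerivAt_nodoid_line (hl : lam < 0) (ha : 0 < a) (θ₀ z₀ φ θ : ℝ) :
    HasDerivAt (fun θ => nodZ lam a θ₀ z₀ θ * Real.cos φ - nodR lam a θ * Real.sin φ)
      (-nodV lam a θ * Real.sin (θ - φ)) θ := by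
  refine (((hasDerivAt_nodZ hl ha θ₀ z₀ θ).mul_const (Real.cos φ)).sub
    ((hasDerivAt_nodR hl ha θ).mul_const (Real.sin φ))).congr_deriv ?_
  rw [Real.sin_sub]
  ring

theorem strictMonoOn_nodoid_line (hl : lam < 0) (ha : 0 < a) (θ₀ z₀ φ : ℝ) :
    StrictMonoOn (fun θ => nodZ lam a θ₀ z₀ θ * Real.cos φ - nodR lam a θ * Real.sin φ)
      (Icc (φ - Real.pi) φ) := by
  refine strictMonoOn_of_deriv_pos (convex_Icc _ _) (fun x _ =>
    (hasDerivAt_nodoid_line hl ha θ₀ z₀ φ x).continuousAt.continuousWithinAt) fun x hx => ?_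
  rw [interior_Icc] at hx
  rw [(hasDerivAt_nodoid_line hl ha θ₀ z₀ φ x).deriv]
  exact mul_pos_of_neg_of_neg (neg_lt_zero.2 (nodV_pos hl ha x))
    (Real.sin_neg_of_neg_of_neg_pi_lt (by linarith [hx.2]) (by linarith [hx.1]))

/-- Two nodoid arcs which start at a common point `(rb, zb)` with angles `θ₁ < 0 < θ₂`,
`θ₂ - θ₁ < π`, are separated by the tangent of the second one. -/
theorem nodoid_arcs_inter {b rb zb θ₁ θ₂ x y : ℝ} (hl : lam < 0) (ha : 0 < a) (hb : 0 < b)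
    (hθ₂ : θ₂ ≤ Real.pi / 2) (h12 : θ₂ - θ₁ < Real.pi) (hr₁ : nodR lam a θ₁ = rb)
    (hr₂ : nodR lam b θ₂ = rb) (hab : a < rb) (hx : x ∈ Icc θ₁ Real.pi) (hy : y ∈ Icc 0 θ₂)
    (hr : nodR lam a x = nodR lam b y) (hz : nodZ lam a θ₁ zb x = nodZ lam b θ₂ zb y) :
    x = θ₁ := by
  have hπ := Real.pi_pos
  have hrb : 0 < rb := ha.trans hab
  have hr₂y : rb ≤ nodR lam b y := by
    rw [le_nodR_iff hl hb hrb, (nodR_eq_iff hl hb hrb).1 hr₂]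
    exact mul_le_mul_of_nonneg_right (Real.sin_le_sin_of_le_of_le_pi_div_two
      (by linarith [hy.1]) hθ₂ hy.2) hrb.le
  have hx0 : x ≤ 0 := by
    by_contra! h
    have := nodR_le_self hl ha (Real.sin_nonneg_of_nonneg_of_le_pi h.le hx.2)
    linarith
  by_contra hne
  have hlt : θ₁ < x := lt_of_le_of_ne hx.1 (Ne.symm hne)
  have h1 := strictMonoOn_nodoid_line hl ha θ₁ zb θ₂ ⟨by linarith, by linarith [hy.1, hy.2]⟩
    ⟨by linarith, by linarith [hy.1, hy.2]⟩ hlt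
  have h2 := (strictMonoOn_nodoid_line hl hb θ₂ zb θ₂).monotoneOn ⟨by linarith [hy.1], hy.2⟩
    ⟨by linarith, le_rfl⟩ hy.2
  simp only [nodZ_self, hr₁, hr₂, hr, hz] at h1 h2
  linarith

end Separation

section Sufficiency

variable {A σ β θc : ℝ}

/-- Standing assumptions on the data together with the consequences of the first constraint. -/
structure Admissible (β θc A σ : ℝ) : Prop where
  A_pos : 0 < A
  σ_pos : 0 < σ
  lt_one : A ^ 2 + σ ^ 2 < 1
  β_mem : β ∈ Ioo (Real.pi / 2) Real.pi
  θc_mem : θc ∈ Ioc 0 Real.pi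
  lam_neg : lamOf A σ β < 0
  a_pos : 0 < aOf A σ β

namespace Admissible

theorem r₁_θBar₁ (h : Admissible β θc A σ) :
    r₁ (lamOf A σ β) (aOf A σ β) (θBar₁ A (rBar A σ) β) = rBar A σ :=
  (nodR_eq_iff h.lam_neg h.a_pos (rBar_pos h.A_pos σ)).2
    (lamOf_mul_sub h.A_pos h.σ_pos h.lt_one h.lam_neg h.a_pos)

theorem r₂_θBar₂ (h : Admissible β θc A σ) :
    r₂ (lamOf A σ β) (θBar₂ A (rBar A σ) β) = rBar A σ :=
  (nodR_eq_iff h.lam_neg one_pos (rBar_pos h.A_pos σ)).2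
    (lamOf_mul h.A_pos h.σ_pos h.lt_one β)

theorem a_lt_rBar (h : Admissible β θc A σ) : aOf A σ β < rBar A σ := by
  have hm := θBar₁_mem h.A_pos h.σ_pos h.β_mem
  rw [← h.r₁_θBar₁]
  exact lt_nodR_of_sin_neg h.lam_neg h.a_pos (Real.sin_neg_of_neg_of_neg_pi_lt hm.2 hm.1)

theorem r₁_ne_cosh_of_inter (h : Admissible β θc A σ) {θ : ℝ} (hθ : θ ∈ Icc 0 θc)
    (hinter : Γ₁ A (rBar A σ) (lamOf A σ β) (aOf A σ β) β θc ∩ Γ₃ A (rBar A σ) =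
      {(rBar A σ, zBar A (rBar A σ))})
    (hz : z₁ A (rBar A σ) (lamOf A σ β) (aOf A σ β) β θ ∈ Icc 0 (zBar A (rBar A σ))) :
    r₁ (lamOf A σ β) (aOf A σ β) θ ≠
      A * Real.cosh (z₁ A (rBar A σ) (lamOf A σ β) (aOf A σ β) β θ / A) := by
  intro hr
  have hm₃ := θBar₃_mem h.A_pos h.σ_pos
  have hm₁ := θBar₁_mem h.A_pos h.σ_pos h.β_mem
  have hs : ∀ x ∈ Icc (θBar₃ A (rBar A σ)) (Real.pi / 2), 0 < Real.sin x := fun x hx =>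
    Real.sin_pos_of_pos_of_lt_pi (by linarith [hx.1, hm₃.1]) (by linarith [hx.2, Real.pi_pos])
  have hivt := intermediate_value_Icc' hm₃.2.le (f := catZ A) fun x hx =>
    (hasDerivAt_catZ (hs x hx)).continuousAt.continuousWithinAt
  rw [catZ_pi_div_two, ← zBar_eq_catZ h.A_pos h.σ_pos] at hivt
  obtain ⟨x, hx, hxz⟩ := hivt hz
  have hmem : (r₁ (lamOf A σ β) (aOf A σ β) θ, z₁ A (rBar A σ) (lamOf A σ β) (aOf A σ β) β θ) ∈
      ({(rBar A σ, zBar A (rBar A σ))} : Set (ℝ × ℝ)) := by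
    rw [← hinter]
    refine ⟨⟨θ, ⟨by linarith [hθ.1, hm₁.2], hθ.2⟩, rfl⟩, ⟨x, hx, ?_⟩⟩
    simp only [Prod.mk.injEq]
    exact ⟨by rw [catR_eq_cosh h.A_pos (hs x hx), hxz, hr], hxz⟩
  have h1 : r₁ (lamOf A σ β) (aOf A σ β) θ = rBar A σ := (Prod.mk.inj hmem).1
  have h2 := nodR_le_self h.lam_neg h.a_pos
    (Real.sin_nonneg_of_nonneg_of_le_pi hθ.1 (hθ.2.trans h.θc_mem.2))
  rw [r₁] at h1
  linarith [h.a_lt_rBar]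

/-- The inner surface meets the substrate inside the grain boundary. -/
theorem foot_lt (h : Admissible β θc A σ)
    (hz : z₁ A (rBar A σ) (lamOf A σ β) (aOf A σ β) β θc = 0)
    (hinter : Γ₁ A (rBar A σ) (lamOf A σ β) (aOf A σ β) β θc ∩ Γ₃ A (rBar A σ) =
      {(rBar A σ, zBar A (rBar A σ))}) :
    r₁ (lamOf A σ β) (aOf A σ β) θc < A := by
  have hl := h.lam_neg
  have ha := h.a_pos
  have hm₁ := θBar₁_mem h.A_pos h.σ_pos h.β_mem
  have hzb := zBar_pos h.A_pos h.σ_pos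
  set zf := z₁ A (rBar A σ) (lamOf A σ β) (aOf A σ β) β with hzf
  set rf := r₁ (lamOf A σ β) (aOf A σ β) with hrf
  have hzc : Continuous zf := (contDiff_nodZ hl ha _ _).continuous
  have hrc : Continuous rf := (contDiff_nodR hl ha).continuous
  have hanti : StrictAntiOn zf (Icc 0 Real.pi) := strictAntiOn_nodZ hl ha _ _
  have hz0 : zBar A (rBar A σ) ≤ zf 0 := by
    have := (strictMonoOn_nodZ hl ha (θBar₁ A (rBar A σ) β) (zBar A (rBar A σ))).monotoneOn
      ⟨hm₁.1.le, hm₁.2.le⟩ ⟨by linarith [Real.pi_pos], le_rfl⟩ hm₁.2.le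
    rwa [nodZ_self] at this
  obtain ⟨t, ht, htz⟩ := intermediate_value_Icc' h.θc_mem.1.le hzc.continuousOn
    (show zBar A (rBar A σ) ∈ Icc (zf θc) (zf 0) from ⟨by rw [hz]; exact hzb.le, hz0⟩)
  by_contra! hge
  have hrt : rf t ≤ aOf A σ β := nodR_le_self hl ha
    (Real.sin_nonneg_of_nonneg_of_le_pi ht.1 (ht.2.trans h.θc_mem.2))
  have hcosh : A * Real.cosh (zBar A (rBar A σ) / A) = rBar A σ := by
    rw [zBar_eq_catZ h.A_pos h.σ_pos, ← catR_eq_cosh h.A_pos, catR_θBar₃ h.A_pos]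
    rw [sin_θBar₃ h.A_pos]
    exact div_pos h.A_pos (rBar_pos h.A_pos σ)
  have hG : Continuous fun θ => rf θ - A * Real.cosh (zf θ / A) :=
    hrc.sub (continuous_const.mul (Real.continuous_cosh.comp (hzc.div_const A)))
  obtain ⟨x, hx, hx0⟩ := intermediate_value_Icc ht.2 hG.continuousOn
    (show (0 : ℝ) ∈ Icc (rf t - A * Real.cosh (zf t / A)) (rf θc - A * Real.cosh (zf θc / A)) by
      rw [htz, hcosh, hz]
      simp only [zero_div, Real.cosh_zero, mul_one, mem_Icc]
      exact ⟨by linarith [h.a_lt_rBar], by linarith⟩)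
  have hxm : x ∈ Icc 0 θc := ⟨ht.1.trans hx.1, hx.2⟩
  have hxπ : x ∈ Icc 0 Real.pi := ⟨hxm.1, hxm.2.trans h.θc_mem.2⟩
  refine h.r₁_ne_cosh_of_inter hxm hinter ⟨?_, ?_⟩ (sub_eq_zero.1 hx0)
  · have := hanti.antitoneOn hxπ ⟨h.θc_mem.1.le, h.θc_mem.2⟩ hx.2
    rwa [hz] at this
  · have := hanti.antitoneOn ⟨ht.1, ht.2.trans h.θc_mem.2⟩ hxπ hx.1
    rwa [htz] at this

theorem r₁_lt_one (h : Admissible β θc A σ)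
    (hcos : Real.cos β < -A / Real.sqrt (σ ^ 2 + A ^ 2) → Real.cos β < -1 / (2 * A)) {θ : ℝ}
    (hθ : θ ∈ Icc (θBar₁ A (rBar A σ) β) θc) : r₁ (lamOf A σ β) (aOf A σ β) θ < 1 := by
  have hiff : ∀ {θ}, r₁ (lamOf A σ β) (aOf A σ β) θ < 1 ↔ 2 * A * Real.cos β < Real.sin θ :=
    nodR_lt_one_iff h.lt_one h.lam_neg h.a_pos
  rw [hiff]
  rcases lt_or_ge (θBar₁ A (rBar A σ) β) (-(Real.pi / 2)) with h1 | h1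
  · have h2 := (cos_lt_neg_inv_iff h.A_pos).1
      (hcos ((cos_lt_iff_θBar₁_lt h.A_pos h.σ_pos h.β_mem).2 h1))
    exact h2.trans_le (Real.neg_one_le_sin θ)
  rcases le_or_gt 0 θ with h0 | h0
  · have h2 := Real.sin_nonneg_of_nonneg_of_le_pi h0 (hθ.2.trans h.θc_mem.2)
    have h3 := mul_neg_of_pos_of_neg h.A_pos (cos_neg_of_mem h.β_mem)
    linarith
  · have h2 := h.r₁_θBar₁.trans_lt (rBar_lt_one h.lt_one)
    exact (hiff.1 h2).trans_le
      (Real.sin_le_sin_of_le_of_le_pi_div_two h1 (by linarith [Real.pi_pos]) hθ.1)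

theorem zBar_le_z₁ (h : Admissible β θc A σ) {θ : ℝ}
    (hθ : θ ∈ Icc (θBar₁ A (rBar A σ) β) 0) :
    zBar A (rBar A σ) ≤ z₁ A (rBar A σ) (lamOf A σ β) (aOf A σ β) β θ := by
  have hm₁ := θBar₁_mem h.A_pos h.σ_pos h.β_mem
  have := (strictMonoOn_nodZ h.lam_neg h.a_pos (θBar₁ A (rBar A σ) β)
    (zBar A (rBar A σ))).monotoneOn ⟨hm₁.1.le, hm₁.2.le⟩ ⟨hm₁.1.le.trans hθ.1, hθ.2⟩ hθ.1
  rwa [nodZ_self] at this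

theorem z₁_pos (h : Admissible β θc A σ)
    (hz : z₁ A (rBar A σ) (lamOf A σ β) (aOf A σ β) β θc = 0) {θ : ℝ}
    (hθ : θ ∈ Ico (θBar₁ A (rBar A σ) β) θc) :
    0 < z₁ A (rBar A σ) (lamOf A σ β) (aOf A σ β) β θ := by
  rcases le_or_gt θ 0 with h0 | h0
  · exact (zBar_pos h.A_pos h.σ_pos).trans_le (h.zBar_le_z₁ ⟨hθ.1, h0⟩)
  · rw [← hz]
    exact strictAntiOn_nodZ h.lam_neg h.a_pos _ _ ⟨h0.le, hθ.2.le.trans h.θc_mem.2⟩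
      ⟨h.θc_mem.1.le, h.θc_mem.2⟩ hθ.2

theorem zBar_le_z₂ (h : Admissible β θc A σ) {θ : ℝ}
    (hθ : θ ∈ Icc 0 (θBar₂ A (rBar A σ) β)) :
    zBar A (rBar A σ) ≤ z₂ A (rBar A σ) (lamOf A σ β) β θ := by
  have hm₂ := θBar₂_mem h.A_pos h.σ_pos h.lt_one h.β_mem h.lam_neg
  have hm₃ := θBar₃_mem h.A_pos h.σ_pos
  have hπ : θBar₂ A (rBar A σ) β ≤ Real.pi := by linarith [hm₂.2, hm₃.2, Real.pi_pos]
  have := (strictAntiOn_nodZ h.lam_neg one_pos (θBar₂ A (rBar A σ) β)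
    (zBar A (rBar A σ))).antitoneOn ⟨hθ.1, hθ.2.trans hπ⟩ ⟨hm₂.1.le, hπ⟩ hθ.2
  rwa [nodZ_self] at this

theorem rBar_le_r₂ (h : Admissible β θc A σ) {θ : ℝ}
    (hθ : θ ∈ Icc 0 (θBar₂ A (rBar A σ) β)) : rBar A σ ≤ r₂ (lamOf A σ β) θ := by
  have hm₂ := θBar₂_mem h.A_pos h.σ_pos h.lt_one h.β_mem h.lam_neg
  have hm₃ := θBar₃_mem h.A_pos h.σ_pos
  have hr := rBar_pos h.A_pos σ
  rw [r₂, le_nodR_iff h.lam_neg one_pos hr, lamOf_mul h.A_pos h.σ_pos h.lt_one]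
  exact mul_le_mul_of_nonneg_right (Real.sin_le_sin_of_le_of_le_pi_div_two
      (by linarith [hθ.1, Real.pi_pos]) (hm₂.2.le.trans hm₃.2.le) hθ.2) hr.le

theorem r₂_lt_one (h : Admissible β θc A σ) {θ : ℝ}
    (hθ : θ ∈ Ioc 0 (θBar₂ A (rBar A σ) β)) : r₂ (lamOf A σ β) θ < 1 := by
  have hm₂ := θBar₂_mem h.A_pos h.σ_pos h.lt_one h.β_mem h.lam_neg
  have hm₃ := θBar₃_mem h.A_pos h.σ_pos
  rw [r₂, nodR_lt_iff h.lam_neg one_pos one_pos, sub_self, mul_zero, mul_one]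
  exact Real.sin_pos_of_pos_of_lt_pi hθ.1 (by linarith [hθ.2, hm₂.2, hm₃.2, Real.pi_pos])

theorem sin_pos_of_mem (h : Admissible β θc A σ) {θ : ℝ}
    (hθ : θ ∈ Icc (θBar₃ A (rBar A σ)) (Real.pi / 2)) : 0 < Real.sin θ := by
  have hm₃ := θBar₃_mem h.A_pos h.σ_pos
  exact Real.sin_pos_of_pos_of_lt_pi (hm₃.1.trans_le hθ.1) (by linarith [hθ.2, Real.pi_pos])

theorem catR_le_rBar (h : Admissible β θc A σ) {θ : ℝ}
    (hθ : θ ∈ Icc (θBar₃ A (rBar A σ)) (Real.pi / 2)) : catR A θ ≤ rBar A σ := by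
  have hm₃ := θBar₃_mem h.A_pos h.σ_pos
  rw [← catR_θBar₃ h.A_pos σ]
  exact div_le_div_of_nonneg_left h.A_pos.le (h.sin_pos_of_mem ⟨le_rfl, hm₃.2.le⟩)
    (Real.sin_le_sin_of_le_of_le_pi_div_two (by linarith [hm₃.1, Real.pi_pos]) hθ.2 hθ.1)

theorem catZ_pos (h : Admissible β θc A σ) {θ : ℝ}
    (hθ : θ ∈ Ico (θBar₃ A (rBar A σ)) (Real.pi / 2)) : 0 < catZ A θ := by
  have hm₃ := θBar₃_mem h.A_pos h.σ_pos
  rw [← catZ_pi_div_two A]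
  exact strictAntiOn_catZ h.A_pos ⟨hm₃.1.trans_le hθ.1, by linarith [hθ.2, Real.pi_pos]⟩
    ⟨by linarith [Real.pi_pos], by linarith [Real.pi_pos]⟩ hθ.2

theorem injOn_catenoid (h : Admissible β θc A σ) :
    InjOn (fun θ => (catR A θ, catZ A θ)) (Icc (θBar₃ A (rBar A σ)) (Real.pi / 2)) := by
  have hm₃ := θBar₃_mem h.A_pos h.σ_pos
  intro x hx y hy hxy
  exact (strictAntiOn_catZ h.A_pos).injOn
    ⟨hm₃.1.trans_le hx.1, by linarith [hx.2, Real.pi_pos]⟩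
    ⟨hm₃.1.trans_le hy.1, by linarith [hy.2, Real.pi_pos]⟩ (Prod.mk.inj hxy).2

end Admissible

end Sufficiency

section Existence

variable {A σ β θc : ℝ}

theorem Admissible.catZ_le_zBar (h : Admissible β θc A σ) {θ : ℝ}
    (hθ : θ ∈ Icc (θBar₃ A (rBar A σ)) (Real.pi / 2)) : catZ A θ ≤ zBar A (rBar A σ) := by
  have hm₃ := θBar₃_mem h.A_pos h.σ_pos
  rw [zBar_eq_catZ h.A_pos h.σ_pos]
  exact (strictAntiOn_catZ h.A_pos).antitoneOn ⟨hm₃.1, by linarith [hm₃.2, Real.pi_pos]⟩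
    ⟨hm₃.1.trans_le hθ.1, by linarith [hθ.2, Real.pi_pos]⟩ hθ.1

/-- Curves that are functions of their tangent angle with constant or vanishing mean curvature
and satisfy the boundary conditions form a steady state. -/
theorem isSteadyState_of_const_H {𝒜 ℬ lam : ℝ} {P₁ P₂ P₃ : Profile}
    (hreg : ∀ P ∈ ({P₁, P₂, P₃} : Set Profile), ∀ I, P.static.IsRegular I)
    (hbc : BoundaryConditions β θc P₁ P₂ P₃)
    (h₁ : ∀ α ∈ Icc (0 : ℝ) 1, P₁.H α = lam) (h₂ : ∀ α ∈ Icc (0 : ℝ) 1, P₂.H α = lam)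
    (h₃ : ∀ α ∈ Icc (0 : ℝ) 1, P₃.H α = 0) : IsSteadyState 𝒜 ℬ β θc P₁ P₂ P₃ := by
  have hv : ∀ (P : Profile) (α t : ℝ), P.static.scaledNormalVelocity α t = 0 := fun P α t => by
    simp [MovingCurve.scaledNormalVelocity, Profile.static]
  have hsd : ∀ (P : Profile), (∀ α ∈ Icc (0 : ℝ) 1, P.H α = lam) → ∀ α ∈ Icc (0 : ℝ) 1,
      dα (fun a => P.r a * dα P.H a) α = 0 := fun P hP α hα =>
    dα_eq_zero_of_eqOn_const (c := 0)
      (fun x hx => by rw [dα_eq_zero_of_eqOn_const hP hx, mul_zero]) hα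
  refine
  { regular₁ := hreg P₁ (by simp) _
    regular₂ := hreg P₂ (by simp) _
    regular₃ := hreg P₃ (by simp) _
    conditions := fun t _ => hbc
    surfaceDiffusion := ?_
    meanCurvatureFlow := ?_ }
  · rintro M (rfl | rfl) t - - α hα
    · have := hsd P₁ h₁ α (Ioo_subset_Icc_self hα)
      rw [hv]
      simp only [Profile.static, MovingCurve.at_] at this ⊢
      rw [this, mul_zero, zero_div]
    · have := hsd P₂ h₂ α (Ioo_subset_Icc_self hα)
      rw [hv]
      simp only [Profile.static, MovingCurve.at_] at this ⊢
      rw [this, mul_zero, zero_div]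
  · intro t _ _ α hα
    have := h₃ α (Ioo_subset_Icc_self hα)
    rw [hv]
    simp only [Profile.static, MovingCurve.at_] at this ⊢
    rw [this, mul_zero]

theorem boundaryConditions_of_isAngleParam (h : Admissible β θc A σ)
    (hC : Constraints β θc A σ) {P₁ P₂ P₃ : Profile} {ℓ₁ ℓ₂ ℓ₃ : ℝ}
    (hP₁ : P₁.IsAngleParam (r₁ (lamOf A σ β) (aOf A σ β))
      (z₁ A (rBar A σ) (lamOf A σ β) (aOf A σ β) β) (nodV (lamOf A σ β) (aOf A σ β))
      (θBar₁ A (rBar A σ) β) θc ℓ₁)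
    (hP₂ : P₂.IsAngleParam (r₂ (lamOf A σ β)) (z₂ A (rBar A σ) (lamOf A σ β) β)
      (nodV (lamOf A σ β) 1) 0 (θBar₂ A (rBar A σ) β) ℓ₂)
    (hP₃ : P₃.IsAngleParam (catR A) (catZ A) (fun θ => A / Real.sin θ ^ 2)
      (θBar₃ A (rBar A σ)) (Real.pi / 2) ℓ₃) :
    BoundaryConditions β θc P₁ P₂ P₃ := by
  have hπ := Real.pi_pos
  have hl := h.lam_neg
  have ha := h.a_pos
  have hm₁ := θBar₁_mem h.A_pos h.σ_pos h.β_mem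
  have hm₂ := θBar₂_mem h.A_pos h.σ_pos h.lt_one h.β_mem hl
  have hm₃ := θBar₃_mem h.A_pos h.σ_pos
  have h01 : (0 : ℝ) ∈ Icc (0 : ℝ) 1 := ⟨le_rfl, zero_le_one⟩
  have h11 : (1 : ℝ) ∈ Icc (0 : ℝ) 1 := ⟨zero_le_one, le_rfl⟩
  have hH₁ : ∀ α ∈ Icc (0 : ℝ) 1, P₁.H α = lamOf A σ β := fun α hα => hP₁.H_eq_lam hl ha hα
  have hH₂ : ∀ α ∈ Icc (0 : ℝ) 1, P₂.H α = lamOf A σ β := fun α hα => hP₂.H_eq_lam hl one_pos hα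
  have hr₁1 : P₁.r 1 = rBar A σ := by rw [hP₁.r_eq, hP₁.angle_one, h.r₁_θBar₁]
  have hz₁1 : P₁.z 1 = zBar A (rBar A σ) := by rw [hP₁.z_eq, hP₁.angle_one, z₁, nodZ_self]
  have hr₂0 : P₂.r 0 = rBar A σ := by rw [hP₂.r_eq, hP₂.angle_zero, h.r₂_θBar₂]
  have hz₂0 : P₂.z 0 = zBar A (rBar A σ) := by rw [hP₂.z_eq, hP₂.angle_zero, z₂, nodZ_self]
  have hr₃1 : P₃.r 1 = rBar A σ := by rw [hP₃.r_eq, hP₃.angle_one, catR_θBar₃ h.A_pos]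
  have hz₃1 : P₃.z 1 = zBar A (rBar A σ) := by
    rw [hP₃.z_eq, hP₃.angle_one, zBar_eq_catZ h.A_pos h.σ_pos]
  have hr₃0 : P₃.r 0 = A := by rw [hP₃.r_eq, hP₃.angle_zero, catR_pi_div_two]
  have hA1 : A < 1 := by nlinarith [h.A_pos, h.lt_one, sq_nonneg σ]
  have hcos : ∀ x y : ℝ, Real.cos x * Real.cos y + Real.sin x * Real.sin y = Real.cos (y - x) :=
    fun x y => by rw [Real.cos_sub]; ring
  refine
  { normalized₁ := hP₁.isNormalized hm₁.1 h.θc_mem.2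
      ((injOn_nodoid hl ha _ _).mono fun x hx =>
        mem_Ioc.2 ⟨hm₁.1.trans_le hx.1, hx.2.trans h.θc_mem.2⟩)
    normalized₂ := hP₂.isNormalized (by linarith) (by linarith [hm₂.2, hm₃.2])
      ((injOn_nodoid hl one_pos _ _).mono fun x hx =>
        mem_Ioc.2 ⟨by linarith [hx.1], by linarith [hx.2, hm₂.2, hm₃.2]⟩)
    normalized₃ := hP₃.isNormalized (by linarith [hm₃.1]) (by linarith) h.injOn_catenoid
    start₁ := by rw [hP₁.z_eq, hP₁.angle_zero, hC.z₁_eq]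
    start₃ := by rw [hP₃.z_eq, hP₃.angle_zero, catZ_pi_div_two]
    end₂ := by rw [hP₂.r_eq, hP₂.angle_one, r₂, nodR_zero hl one_pos]
    junction₁ := ⟨by rw [hr₁1, hr₃1], by rw [hz₁1, hz₃1]⟩
    junction₂ := ⟨by rw [hr₂0, hr₃1], by rw [hz₂0, hz₃1]⟩
    feet := by
      rw [hr₃0, hP₁.r_eq, hP₁.angle_zero]
      exact ⟨nodR_pos hl ha _, h.foot_lt hC.z₁_eq hC.inter, hA1⟩
    top := by
      rw [hP₂.z_eq]
      exact (zBar_pos h.A_pos h.σ_pos).trans_le (h.zBar_le_z₂ (hP₂.angle_mem_Icc h11))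
    junction_mem := by
      rw [hr₃1, hz₃1]
      exact ⟨rBar_pos h.A_pos σ, rBar_lt_one h.lt_one, zBar_pos h.A_pos h.σ_pos⟩
    contact₁ := ⟨by rw [hP₁.τr_eq h01, hP₁.angle_zero], hP₁.angle_zero⟩
    contact₂ := ⟨by rw [hP₂.τz_eq h11, hP₂.angle_one, Real.sin_zero], hP₂.angle_one⟩
    contact₃ := ⟨by rw [hP₃.τr_eq h01, hP₃.angle_zero, Real.cos_pi_div_two], hP₃.angle_zero⟩
    herring₁ := by
      rw [hP₁.τr_eq h11, hP₁.τz_eq h11, hP₃.τr_eq h11, hP₃.τz_eq h11, hcos, hP₁.angle_one,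
        hP₃.angle_one, θBar₁, sub_sub_cancel]
      exact ⟨rfl, by ring⟩
    herring₂ := by
      rw [hP₂.τr_eq h01, hP₂.τz_eq h01, hP₃.τr_eq h11, hP₃.τz_eq h11, hcos, hP₂.angle_zero,
        hP₃.angle_one, θBar₂]
      refine ⟨?_, by ring⟩
      rw [show ∀ x : ℝ, x - (x - Real.pi + β) = Real.pi - β from fun x => by ring,
        Real.cos_pi_sub, neg_neg]
    potential := by rw [hH₁ 1 h11, hH₂ 0 h01]
    flux₁ := dα_eq_zero_of_eqOn_const hH₁ h01
    flux_junction := by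
      rw [dα_eq_zero_of_eqOn_const hH₁ h11, dα_eq_zero_of_eqOn_const hH₂ h01, zero_div, zero_div]
    flux₂ := dα_eq_zero_of_eqOn_const hH₂ h11
    r₁_mem := fun α hα => by
      rw [hP₁.r_eq]
      exact ⟨nodR_pos hl ha _, h.r₁_lt_one hC.cos_lt (hP₁.angle_mem_Icc hα)⟩
    r₂_mem := fun α hα => by
      rw [hP₂.r_eq]
      exact ⟨nodR_pos hl one_pos _, h.r₂_lt_one (hP₂.angle_mem_Ioc hα)⟩
    r₃_mem := fun α hα => by
      rw [hP₃.r_eq]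
      have hθ := hP₃.angle_mem_Icc hα
      exact ⟨div_pos h.A_pos (h.sin_pos_of_mem hθ),
        (h.catR_le_rBar hθ).trans_lt (rBar_lt_one h.lt_one)⟩
    z₁_pos := fun α hα => by
      rw [hP₁.z_eq]
      exact h.z₁_pos hC.z₁_eq (hP₁.angle_mem_Ico hα)
    z₂_pos := fun α hα => by
      rw [hP₂.z_eq]
      exact (zBar_pos h.A_pos h.σ_pos).trans_le (h.zBar_le_z₂ (hP₂.angle_mem_Icc hα))
    z₃_pos := fun α hα => by
      rw [hP₃.z_eq]
      exact h.catZ_pos (hP₃.angle_mem_Ico hα)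
    inter₁₂ := ?_
    inter₁₃ := ?_
    inter₂₃ := ?_ }
  · rw [hr₃1, hz₃1]
    refine Subset.antisymm ?_ ?_
    · rintro _ ⟨⟨α, hα, rfl⟩, ⟨α', hα', he⟩⟩
      have hr : P₂.r α' = P₁.r α := (Prod.mk.inj he).1
      have hz : P₂.z α' = P₁.z α := (Prod.mk.inj he).2
      rw [hP₂.r_eq, hP₁.r_eq] at hr
      rw [hP₂.z_eq, hP₁.z_eq] at hz
      have hx := hP₁.angle_mem_Icc hα
      have key := nodoid_arcs_inter hl ha one_pos (hm₂.2.le.trans hm₃.2.le)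
        (by rw [θBar₁, θBar₂]; linarith [h.β_mem.2]) h.r₁_θBar₁ h.r₂_θBar₂ h.a_lt_rBar
        ⟨hx.1, hx.2.trans h.θc_mem.2⟩ (hP₂.angle_mem_Icc hα') hr.symm hz.symm
      simp only [mem_singleton_iff, hP₁.r_eq, hP₁.z_eq, key, h.r₁_θBar₁, z₁, nodZ_self]
    · rintro _ rfl
      exact ⟨⟨1, h11, by simp only [hr₁1, hz₁1]⟩, ⟨0, h01, by simp only [hr₂0, hz₂0]⟩⟩
  · rw [hr₃1, hz₃1, hP₁.isGivenBy.trace_eq, hP₃.isGivenBy.trace_eq]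
    exact hC.inter
  · rw [hr₃1, hz₃1]
    refine Subset.antisymm ?_ ?_
    · rintro _ ⟨⟨α, hα, rfl⟩, ⟨α', hα', he⟩⟩
      have hr : P₃.r α' = P₂.r α := (Prod.mk.inj he).1
      have hz : P₃.z α' = P₂.z α := (Prod.mk.inj he).2
      have hr2 := h.rBar_le_r₂ (hP₂.angle_mem_Icc hα)
      have hz2 := h.zBar_le_z₂ (hP₂.angle_mem_Icc hα)
      have hr3 := h.catR_le_rBar (hP₃.angle_mem_Icc hα')
      have hz3 := h.catZ_le_zBar (hP₃.angle_mem_Icc hα')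
      rw [← hP₂.r_eq] at hr2
      rw [← hP₂.z_eq] at hz2
      rw [← hP₃.r_eq] at hr3
      rw [← hP₃.z_eq] at hz3
      exact Prod.ext (by simp only; linarith) (by simp only; linarith)
    · rintro _ rfl
      exact ⟨⟨0, h01, by simp only [hr₂0, hz₂0]⟩, ⟨1, h11, by simp only [hr₃1, hz₃1]⟩⟩

theorem exists_steadyState (𝒜 ℬ : ℝ) (h : Admissible β θc A σ) (hC : Constraints β θc A σ) :
    ∃ P₁ P₂ P₃ : Profile, IsExplicitSteadyState 𝒜 ℬ β θc A (rBar A σ) (lamOf A σ β)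
      (aOf A σ β) P₁ P₂ P₃ ∧ P₃.length = σ := by
  have hm₁ := θBar₁_mem h.A_pos h.σ_pos h.β_mem
  have hm₂ := θBar₂_mem h.A_pos h.σ_pos h.lt_one h.β_mem h.lam_neg
  obtain ⟨P₁, ℓ₁, hP₁⟩ := exists_isAngleParam_nodoid h.lam_neg h.a_pos (θBar₁ A (rBar A σ) β)
    (zBar A (rBar A σ)) (hm₁.2.trans h.θc_mem.1)
  obtain ⟨P₂, ℓ₂, hP₂⟩ := exists_isAngleParam_nodoid h.lam_neg one_pos (θBar₂ A (rBar A σ) β)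
    (zBar A (rBar A σ)) hm₂.1
  have hP₃ := isAngleParam_catenary h.A_pos h.σ_pos
  rw [θBar₃_eq_arctan h.A_pos h.σ_pos] at hP₃
  refine ⟨P₁, P₂, catenary A σ, ⟨?_, hP₁.isGivenBy, hP₂.isGivenBy, hP₃.isGivenBy⟩,
    hP₃.length_eq⟩
  refine isSteadyState_of_const_H ?_ (boundaryConditions_of_isAngleParam h hC hP₁ hP₂ hP₃)
    (fun α hα => hP₁.H_eq_lam h.lam_neg h.a_pos hα) (fun α hα => hP₂.H_eq_lam h.lam_neg one_pos hα)
    (fun α hα => hP₃.H_eq_zero h.A_pos hα (h.sin_pos_of_mem (hP₃.angle_mem_Icc hα)))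
  rintro P (rfl | rfl | rfl) I
  · exact hP₁.isRegular_static I
  · exact hP₂.isRegular_static I
  · exact hP₃.isRegular_static I

end Existence

/-! ### Steady states given by the explicit curves satisfy the constraints -/

theorem Profile.IsNormalized.speed_ne_zero {P : Profile} (h : P.IsNormalized) {α : ℝ}
    (hα : α ∈ Icc (0 : ℝ) 1) : P.speed α ≠ 0 := by
  intro h0
  have h1 := h.cos_angle α hα
  have h2 := h.sin_angle α hα
  rw [Profile.τr, h0, div_zero] at h1
  rw [Profile.τz, h0, div_zero] at h2
  have := Real.sin_sq_add_cos_sq (P.θ α)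
  rw [h1, h2] at this
  norm_num at this

theorem Profile.IsNormalized.dα_r_eq {P : Profile} (h : P.IsNormalized) {α : ℝ}
    (hα : α ∈ Icc (0 : ℝ) 1) : dα P.r α = P.speed α * Real.cos (P.θ α) := by
  rw [h.cos_angle α hα, Profile.τr, mul_div_cancel₀ _ (h.speed_ne_zero hα)]

section Static

variable {P : Profile} {I : Set ℝ}

theorem MovingCurve.IsRegular.contDiffOn_r (h : P.static.IsRegular I) {t : ℝ} (ht : t ∈ I) :
    ContDiffOn ℝ 4 P.r (Icc 0 1) :=
  h.contDiff_r.comp (f := fun α : ℝ => (α, t)) (contDiff_id.prodMk contDiff_const).contDiffOn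
    fun _ hα => ⟨hα, ht⟩

theorem MovingCurve.IsRegular.contDiffOn_z (h : P.static.IsRegular I) {t : ℝ} (ht : t ∈ I) :
    ContDiffOn ℝ 4 P.z (Icc 0 1) :=
  h.contDiff_z.comp (f := fun α : ℝ => (α, t)) (contDiff_id.prodMk contDiff_const).contDiffOn
    fun _ hα => ⟨hα, ht⟩

theorem MovingCurve.IsRegular.continuousOn_angle (h : P.static.IsRegular I) {t : ℝ}
    (ht : t ∈ I) : ContinuousOn P.θ (Icc 0 1) :=
  h.continuous_θ.comp (f := fun α : ℝ => (α, t)) (by fun_prop) fun _ hα => ⟨hα, ht⟩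

end Static

theorem continuousOn_speed {P : Profile} (hr : ContDiffOn ℝ 4 P.r (Icc 0 1))
    (hz : ContDiffOn ℝ 4 P.z (Icc 0 1)) : ContinuousOn P.speed (Icc 0 1) := by
  have h1 := hr.continuousOn_derivWithin (uniqueDiffOn_Icc zero_lt_one) (by norm_num)
  have h2 := hz.continuousOn_derivWithin (uniqueDiffOn_Icc zero_lt_one) (by norm_num)
  exact ((h1.pow 2).add (h2.pow 2)).sqrt

/-- A curve without self-intersections that is a function of its tangent angle has a strictly
decreasing tangent angle if it starts at the largest one. -/
theorem Profile.IsGivenBy.strictAntiOn_angle {P : Profile} {ρ ζ : ℝ → ℝ} {p q : ℝ}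
    (h : P.IsGivenBy ρ ζ (Icc p q)) (hP : P.IsNormalized) (hc : ContinuousOn P.θ (Icc 0 1))
    (h0 : P.θ 0 = q) : StrictAntiOn P.θ (Icc 0 1) := by
  have hinj : InjOn P.θ (Icc 0 1) := by
    intro x hx y hy hxy
    refine hP.injective hx hy ?_
    simp only [(h.2 x hx).1, (h.2 x hx).2, (h.2 y hy).1, (h.2 y hy).2, hxy]
  rcases hc.strictMonoOn_of_injOn_Icc' zero_le_one hinj with hm | hm
  · have h01 := hm (left_mem_Icc.2 zero_le_one) (right_mem_Icc.2 zero_le_one) zero_lt_one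
    have h1 : P.θ 1 ∈ Icc p q := h.1 ▸ mem_image_of_mem _ (right_mem_Icc.2 zero_le_one)
    linarith [h1.2]
  · exact hm

theorem Profile.IsGivenBy.angle_one_eq {P : Profile} {ρ ζ : ℝ → ℝ} {p q : ℝ}
    (h : P.IsGivenBy ρ ζ (Icc p q)) (hθ : StrictAntiOn P.θ (Icc 0 1)) : P.θ 1 = p := by
  have h1 : P.θ 1 ∈ Icc p q := h.1 ▸ mem_image_of_mem _ (right_mem_Icc.2 zero_le_one)
  obtain ⟨x, hx, hxp⟩ : p ∈ P.θ '' Icc 0 1 := h.1 ▸ left_mem_Icc.2 (h1.1.trans h1.2)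
  have := hθ.antitoneOn hx (right_mem_Icc.2 zero_le_one) hx.2
  exact le_antisymm (hxp ▸ this) h1.1

/-- The arc length of a catenary arc starting at the vertex. -/
theorem length_catenary {P : Profile} {A p : ℝ} (hA : 0 < A) (hp : 0 < p)
    (h : P.IsGivenBy (catR A) (catZ A) (Icc p (Real.pi / 2))) (hP : P.IsNormalized)
    (hr : ContDiffOn ℝ 4 P.r (Icc 0 1)) (hz : ContDiffOn ℝ 4 P.z (Icc 0 1))
    (hθ : StrictAntiOn P.θ (Icc 0 1)) (h0 : P.θ 0 = Real.pi / 2) :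
    P.length = Real.sqrt (P.r 1 ^ 2 - A ^ 2) := by
  have h0m : (0 : ℝ) ∈ Icc (0 : ℝ) 1 := left_mem_Icc.2 zero_le_one
  have hr0 : P.r 0 = A := by rw [(h.2 0 h0m).1, h0, catR_pi_div_two]
  have key := intervalIntegral.integral_eq_sub_of_hasDerivAt_of_le (zero_le_one' ℝ)
    (f := fun α => Real.sqrt (P.r α ^ 2 - A ^ 2)) (f' := P.speed)
    (((hr.continuousOn.pow 2).sub continuousOn_const).sqrt) (fun α hα => ?_)
    ((continuousOn_speed hr hz).intervalIntegrable_of_Icc zero_le_one)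
  · simpa [Profile.length, hr0] using key
  · have hαm := Ioo_subset_Icc_self hα
    have hθα : P.θ α ∈ Ico p (Real.pi / 2) :=
      ⟨(h.1 ▸ mem_image_of_mem _ hαm : P.θ α ∈ Icc p (Real.pi / 2)).1, h0 ▸ hθ h0m hαm hα.1⟩
    have hs : 0 < Real.sin (P.θ α) :=
      Real.sin_pos_of_pos_of_lt_pi (hp.trans_le hθα.1) (by linarith [hθα.2, Real.pi_pos])
    have hc : 0 < Real.cos (P.θ α) :=
      Real.cos_pos_of_mem_Ioo ⟨by linarith [hθα.1, Real.pi_pos], hθα.2⟩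
    have hrd : HasDerivAt P.r (P.speed α * Real.cos (P.θ α)) α := by
      rw [← hP.dα_r_eq hαm]
      exact (((hr.differentiableOn (by norm_num)) α hαm).hasDerivWithinAt).hasDerivAt
        (Icc_mem_nhds hα.1 hα.2)
    have hrα : P.r α = A / Real.sin (P.θ α) := (h.2 α hαm).1
    have hsq : P.r α ^ 2 - A ^ 2 = (A * Real.cos (P.θ α) / Real.sin (P.θ α)) ^ 2 := by
      rw [hrα]
      field_simp
      linear_combination -Real.sin_sq_add_cos_sq (P.θ α)
    have hpos : 0 < A * Real.cos (P.θ α) / Real.sin (P.θ α) := by positivity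
    refine (((hrd.pow 2).sub_const (A ^ 2)).sqrt ?_).congr_deriv ?_
    · rw [Pi.pow_apply, hsq]
      positivity
    · rw [Pi.pow_apply, hsq, Real.sqrt_sq hpos.le, hrα]
      simp only [Nat.cast_ofNat, Nat.add_one_sub_one, pow_one]
      field_simp

/-- The grain boundary of a steady state determines `r̄` from its arc length. -/
theorem exists_rBar_eq {P : Profile} {A rb : ℝ} (hA : 0 < A)
    (h : P.IsGivenBy (catR A) (catZ A) (Icc (θBar₃ A rb) (Real.pi / 2))) (hP : P.IsNormalized)
    (hr : ContDiffOn ℝ 4 P.r (Icc 0 1)) (hz : ContDiffOn ℝ 4 P.z (Icc 0 1))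
    (hc : ContinuousOn P.θ (Icc 0 1)) (h0 : P.θ 0 = Real.pi / 2)
    (hr1 : P.r 1 ∈ Ioo 0 1) :
    P.θ 1 = θBar₃ A rb ∧
      ∃ s, 0 < s ∧ A ^ 2 + s ^ 2 < 1 ∧ rb = rBar A s ∧ P.length = s := by
  have h0m : (0 : ℝ) ∈ Icc (0 : ℝ) 1 := left_mem_Icc.2 zero_le_one
  have h1m : (1 : ℝ) ∈ Icc (0 : ℝ) 1 := right_mem_Icc.2 zero_le_one
  have hθ := h.strictAntiOn_angle hP hc h0
  have hθ1 := h.angle_one_eq hθ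
  have hlt : θBar₃ A rb < Real.pi / 2 := by
    rw [← hθ1, ← h0]
    exact hθ h0m h1m zero_lt_one
  have hr1' : P.r 1 = A / Real.sin (θBar₃ A rb) := by rw [(h.2 1 h1m).1, hθ1, catR]
  have hsin : 0 < Real.sin (θBar₃ A rb) := by
    by_contra! hle
    have := hr1.1
    rw [hr1'] at this
    exact this.not_ge (div_nonpos_of_nonneg_of_nonpos hA.le hle)
  have hpos : 0 < θBar₃ A rb := by
    by_contra! hle
    exact hsin.not_ge (Real.sin_nonpos_of_nonpos_of_neg_pi_le hle
      (by linarith [Real.neg_pi_div_two_le_arcsin (A / rb), show θBar₃ A rb = Real.arcsin (A / rb)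
        from rfl, Real.pi_pos]))
  have hAr : 0 < A / rb := Real.arcsin_pos.1 hpos
  have hrb : 0 < rb := by
    by_contra! hle
    exact hAr.not_ge (div_nonpos_of_nonneg_of_nonpos hA.le hle)
  have hArlt : A < rb := (div_lt_one hrb).1 (Real.arcsin_lt_pi_div_two.1 hlt)
  have hrrb : P.r 1 = rb := by
    rw [hr1', θBar₃, Real.sin_arcsin (by linarith) ((div_lt_one hrb).2 hArlt).le]
    field_simp
  have hs2 : 0 < rb ^ 2 - A ^ 2 := by nlinarith
  have hlen := length_catenary hA hpos h hP hr hz hθ h0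
  rw [hrrb] at hlen hr1
  refine ⟨hθ1, Real.sqrt (rb ^ 2 - A ^ 2), Real.sqrt_pos.2 hs2, ?_, ?_, hlen⟩
  · rw [Real.sq_sqrt hs2.le]
    nlinarith [hr1.2]
  · rw [rBar, Real.sq_sqrt hs2.le, sub_add_cancel, Real.sqrt_sq hrb.le]

theorem constraints_of_isExplicitSteadyState {𝒜 ℬ β θc A rb lam a : ℝ} {P₁ P₂ P₃ : Profile}
    (hA : 0 < A) (hβ : β ∈ Ioo (Real.pi / 2) Real.pi) (hθc : θc ∈ Ioc 0 Real.pi) (ha0 : 0 ≤ a)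
    (h : IsExplicitSteadyState 𝒜 ℬ β θc A rb lam a P₁ P₂ P₃) :
    ∃ s, 0 < s ∧ P₃.length = s ∧ rb = rBar A s ∧ lam = lamOf A s β ∧ a = aOf A s β ∧
      Constraints β θc A s := by
  obtain ⟨hsol, hG₁, hG₂, hG₃⟩ := h
  have ht : (0 : ℝ) ∈ timeInterval ⊤ := ⟨le_rfl, EReal.coe_lt_top 0⟩
  have hbc : BoundaryConditions β θc P₁ P₂ P₃ := hsol.conditions 0 ht
  have h0m : (0 : ℝ) ∈ Icc (0 : ℝ) 1 := left_mem_Icc.2 zero_le_one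
  have h1m : (1 : ℝ) ∈ Icc (0 : ℝ) 1 := right_mem_Icc.2 zero_le_one
  obtain ⟨hθ₃1, s, hs, hs1, hrb, hlen⟩ := exists_rBar_eq hA hG₃ hbc.normalized₃
    (hsol.regular₃.contDiffOn_r ht) (hsol.regular₃.contDiffOn_z ht)
    (hsol.regular₃.continuousOn_angle ht) hbc.contact₃.2 (hbc.r₃_mem 1 h1m)
  have hr := rBar_pos hA s
  have hθ₁1 : P₁.θ 1 = θBar₁ A rb β := by
    have := hbc.herring₁.2
    rw [θBar₁]
    linarith
  have hθ₂0 : P₂.θ 0 = θBar₂ A rb β := by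
    have := hbc.herring₂.2
    rw [θBar₂]
    linarith
  have hfoot : 0 < nodR lam a θc := by
    have h1 := hbc.feet.1
    rwa [(hG₁.2 0 h0m).1, hbc.contact₁.2] at h1
  have hl := lam_neg_of_nodR_pos hfoot
  have ha := pos_of_nodR_pos ha0 (Real.sin_nonneg_of_nonneg_of_le_pi hθc.1.le hθc.2) hfoot
  subst hrb
  have hr₃1 : P₃.r 1 = rBar A s := by rw [(hG₃.2 1 h1m).1, hθ₃1, catR_θBar₃ hA]
  have hz₃1 : P₃.z 1 = zBar A (rBar A s) := by
    rw [(hG₃.2 1 h1m).2, hθ₃1, zBar_eq_catZ hA hs]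
  have hj₁ : nodR lam a (θBar₁ A (rBar A s) β) = rBar A s := by
    have := hbc.junction₁.1
    rwa [(hG₁.2 1 h1m).1, hθ₁1, hr₃1] at this
  have hj₂ : nodR lam 1 (θBar₂ A (rBar A s) β) = rBar A s := by
    have := hbc.junction₂.1
    rwa [(hG₂.2 0 h0m).1, hθ₂0, hr₃1] at this
  obtain rfl : lam = lamOf A s β := eq_lamOf hA hs hs1 ((nodR_eq_iff hl one_pos hr).1 hj₂)
  obtain rfl : a = aOf A s β := eq_aOf hA hs hs1 hl ha0 ((nodR_eq_iff hl ha hr).1 hj₁)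
  refine ⟨s, hs, hlen, rfl, rfl, rfl, ?_⟩
  refine
  { tan_gt := tan_gt_of_params hs hs1 hβ hl ha
    cos_lt := fun hcos => ?_
    z₁_eq := ?_
    inter := ?_ }
  · rw [cos_lt_iff_θBar₁_lt hA hs hβ] at hcos
    obtain ⟨α, hα, hαθ⟩ : -(Real.pi / 2) ∈ P₁.θ '' Icc 0 1 :=
      hG₁.1 ▸ ⟨hcos.le, by linarith [hθc.1, Real.pi_pos]⟩
    have h1 := (hbc.r₁_mem α hα).2
    rw [(hG₁.2 α hα).1, hαθ, r₁, nodR_lt_one_iff hs1 hl ha, Real.sin_neg,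
      Real.sin_pi_div_two] at h1
    exact (cos_lt_neg_inv_iff hA).2 h1
  · rw [← hbc.start₁, (hG₁.2 0 h0m).2, hbc.contact₁.2]
  · have h1 := hbc.inter₁₃
    rwa [hr₃1, hz₃1, hG₁.trace_eq, hG₃.trace_eq] at h1

theorem Constraints.admissible {β θc A σ : ℝ} (hC : Constraints β θc A σ)
    (hA : 0 < A) (hσ : 0 < σ) (h1 : A ^ 2 + σ ^ 2 < 1) (hβ : β ∈ Ioo (Real.pi / 2) Real.pi)
    (hθc : θc ∈ Ioc 0 Real.pi) : Admissible β θc A σ :=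
  have h := params_of_tan_gt hA hσ h1 hβ hC.tan_gt
  ⟨hA, hσ, h1, hβ, hθc, h.1, h.2⟩

theorem eq_of_rBar_eq {A s t : ℝ} (hs : 0 < s) (ht : 0 < t) (h : rBar A s = rBar A t) : s = t := by
  have h1 := rBar_sq A s
  rw [h, rBar_sq] at h1
  nlinarith

end GrainHole

end

theorem theorem4p14 (𝒜 ℬ : ℝ) (h𝒜 : 0 < 𝒜) (hℬ : 0 < ℬ) (β θc : ℝ)
    (hβ : β ∈ Set.Ioo (Real.pi / 2) Real.pi) (hθc : θc ∈ Set.Ioc 0 Real.pi)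
    (A σ : ℝ) (hAσ : (A, σ) ∈ GrainHole.Ω₀) :
    -- the formulas, with the parameters as functions of `(A, σ, β)`, give a steady state
    -- if and only if the four constraints hold
    ((∃ P₁ P₂ P₃ : GrainHole.Profile, GrainHole.IsExplicitSteadyState 𝒜 ℬ β θc A
          (GrainHole.rBar A σ) (GrainHole.lamOf A σ β) (GrainHole.aOf A σ β) P₁ P₂ P₃) ↔
        GrainHole.Constraints β θc A σ) ∧
    -- no other choice of the parameters gives a steady state whose grain boundary has length `σ`
    (∀ rb lam a : ℝ, 0 ≤ a →
      ((∃ P₁ P₂ P₃ : GrainHole.Profile,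
          GrainHole.IsExplicitSteadyState 𝒜 ℬ β θc A rb lam a P₁ P₂ P₃ ∧ P₃.length = σ) ↔
        (rb = GrainHole.rBar A σ ∧ lam = GrainHole.lamOf A σ β ∧ a = GrainHole.aOf A σ β ∧
          GrainHole.Constraints β θc A σ))) ∧
    -- under the constraints the parameters lie in the required ranges
    (GrainHole.Constraints β θc A σ →
      GrainHole.rBar A σ ∈ Set.Ioo 0 1 ∧ 0 < GrainHole.zBar A (GrainHole.rBar A σ) ∧
      GrainHole.θBar₃ A (GrainHole.rBar A σ) ∈ Set.Ioo 0 (Real.pi / 2) ∧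
      GrainHole.θBar₁ A (GrainHole.rBar A σ) β ∈ Set.Ioo (-Real.pi) 0 ∧
      GrainHole.θBar₂ A (GrainHole.rBar A σ) β ∈
        Set.Ioo 0 (GrainHole.θBar₃ A (GrainHole.rBar A σ)) ∧
      GrainHole.lamOf A σ β < 0 ∧ GrainHole.aOf A σ β ∈ Set.Ioo 0 1) := by
  obtain ⟨hA, hσ, h1⟩ := GrainHole.mem_Ω₀_iff.1 hAσ
  refine ⟨⟨?_, fun hC => ?_⟩, fun rb lam a ha => ⟨?_, ?_⟩, fun hC => ?_⟩
  · rintro ⟨P₁, P₂, P₃, h⟩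
    obtain ⟨s, hs, -, hr, -, -, hC⟩ :=
      GrainHole.constraints_of_isExplicitSteadyState hA hβ hθc (Real.sqrt_nonneg _) h
    rwa [GrainHole.eq_of_rBar_eq hσ hs hr]
  · obtain ⟨P₁, P₂, P₃, h, -⟩ :=
      GrainHole.exists_steadyState 𝒜 ℬ (hC.admissible hA hσ h1 hβ hθc) hC
    exact ⟨P₁, P₂, P₃, h⟩
  · rintro ⟨P₁, P₂, P₃, h, hlen⟩
    obtain ⟨s, -, hs, hr, hl, ha, hC⟩ :=
      GrainHole.constraints_of_isExplicitSteadyState hA hβ hθc ha h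
    obtain rfl : σ = s := hlen.symm.trans hs
    exact ⟨hr, hl, ha, hC⟩
  · rintro ⟨rfl, rfl, rfl, hC⟩
    exact GrainHole.exists_steadyState 𝒜 ℬ (hC.admissible hA hσ h1 hβ hθc) hC
  · have h := hC.admissible hA hσ h1 hβ hθc
    exact ⟨⟨GrainHole.rBar_pos hA σ, GrainHole.rBar_lt_one h1⟩, GrainHole.zBar_pos hA hσ,
      GrainHole.θBar₃_mem hA hσ, GrainHole.θBar₁_mem hA hσ hβ,
      GrainHole.θBar₂_mem hA hσ h1 hβ h.lam_neg, h.lam_neg, h.a_pos,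
      GrainHole.aOf_lt_one hA h1 hβ h.lam_neg h.a_pos⟩
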